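/- Let $\lambda,\mu\in\mathbb{R}$ satisfy $\mu\ge 0$ and $3\lambda+2\mu>0$ (hence $\lambda+2\mu>0$). The John (harmonic) material with Lamé coefficients $\lambda,\mu$ is the hyperelastic material with stored energy $\widehat w(\delta,\eta)=\mathcal W(\eta^{1/3},\delta/\eta)$, $\delta,\eta>0$, where \[ \mathcal W(x,y)=-2\mu x^{-3}y^{-1}+x^{-2}\Big(\tfrac12(\lambda+2\mu)y^{-2}+2(\lambda+2\mu)y^{-1}+2(\lambda+2\mu)\Big)-x^{-1}\Big((3\lambda+4\mu)y^{-1}+2(3\lambda+4\mu)\Big)+\tfrac12(9\lambda+10\mu), \] i.e. its constitutive functions on $(0,\infty)^2$ are \[ \widehat p_{\mathrm{rad}}=\delta^2\partial_\delta\widehat w,\qquad \widehat p_{\mathrm{tan}}=\widehat p_{\mathrm{rad}}+\tfrac32\,\delta\eta\,\partial_\eta\widehat w . \] For $\rho:[0,\infty)\to\mathbb{R}$ put $m(r)=4\pi\int_0^r\rho(s)s^2\,ds$. A triple $(\rho,p_{\mathrm{rad}},p_{\mathrm{tan}})$ of real functions on $[0,\infty)$ is a \emph{regular static self-gravitating ball}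 of radius $R>0$ if $\mathrm{Int}\{r>0:\rho(r)>0\}=(0,R)$ and: (i) the three functions are in $C^0([0,R])\cap C^1((0,R])$ and, for some potential $\Phi$, \[ \frac{dp_{\mathrm{rad}}}{dr}=-\frac2r(p_{\mathrm{rad}}-p_{\mathrm{tan}})-\rho\frac{d\Phi}{dr},\qquad \frac{d\Phi}{dr}=\frac{m}{r^2}\qquad\text{on }(0,R); \] (ii) $p_{\mathrm{rad}},p_{\mathrm{tan}}>0$ on $[0,R)$; (iii) $p_{\mathrm{rad}}(R)=0$; (iv) $p_{\mathrm{rad}}(0)=p_{\mathrm{tan}}(0)$; (v) $\rho=p_{\mathrm{rad}}=p_{\mathrm{tan}}=0$ on $(R,\infty)$. It is \emph{strongly regular} if moreover the three functions are in $C^1([0,R])$ and their derivatives tend to $0$ as $r\to0^+$. It is a ball of the John material with reference density $\mathcal K>0$ if $p_{\mathrm{rad}}(r)=\widehat p_{\mathrm{rad}}(\delta(r),\eta(r))$ and $p_{\mathrm{tan}}(r)=\widehat p_{\mathrm{tan}}(\delta(r),\eta(r))$ for all $r>0$ with $\rho(r)>0$, where \[ \delta(r)=\frac{\rho(r)}{\mathcal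 K},\qquad \eta(r)=\frac{m(r)}{\frac{4\pi}{3}\mathcal K r^3}. \] \textbf{Theorem.} Let $\mathcal K>0$ and let $\rho_c$ be such that $\delta_c:=\rho_c/\mathcal K>1$. Then there exists a strongly regular static self-gravitating ball of the John material with reference density $\mathcal K$ and central density $\rho(0)=\rho_c$. It is unique, even among regular static self-gravitating balls of the John material with reference density $\mathcal K$ and central density $\rho_c$. Moreover $\partial_\delta\widehat p_{\mathrm{rad}}(\delta_c,\delta_c)>0$ and, for all $r\in(0,R]$, where $R>0$ is the radius of the ball, $\rho(r)>0$ and \[ \partial_\delta\widehat p_{\mathrm{rad}}(\delta(r),\eta(r))>0,\qquad \rho(r)<\rho_c,\qquad \frac{4\pi}{3}\max(\rho(r),\mathcal K)\,r^3<m(r)<\frac{4\pi}{3}\rho_c\,r^3 . \] -/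

import Mathlib

open Topology

namespace ElasticBall

noncomputable section

/-- The mass `m(r) = 4π ∫₀ʳ ρ(s) s² ds` enclosed in the ball of radius `r`. -/
def mass (ρ : ℝ → ℝ) (r : ℝ) : ℝ :=
  4 * Real.pi * ∫ s in (0 : ℝ)..r, ρ s * s ^ 2

/-- The normalized density `δ(r) = ρ(r) / K`. -/
def normDensity (K : ℝ) (ρ : ℝ → ℝ) (r : ℝ) : ℝ :=
  ρ r / K

/-- The normalized mean density `η(r) = m(r) / ((4π/3) K r³)`. -/
def meanDensity (K : ℝ) (ρ : ℝ → ℝ) (r : ℝ) : ℝ :=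
  mass ρ r / (4 * Real.pi / 3 * K * r ^ 3)

/-- A regular static self-gravitating ball of matter of radius `R`. Profiles are functions of the
radius `r ≥ 0`; their values at negative arguments are irrelevant. -/
structure IsRegularBall (R : ℝ) (ρ prad ptan : ℝ → ℝ) : Prop where
  radius_pos : 0 < R
  /-- The interior of the matter support is `(0, R)`. -/
  support : interior {r : ℝ | 0 < r ∧ 0 < ρ r} = Set.Ioo 0 R
  continuousOn_density : ContinuousOn ρ (Set.Icc 0 R)
  continuousOn_prad : ContinuousOn prad (Set.Icc 0 R)
  continuousOn_ptan : ContinuousOn ptan (Set.Icc 0 R)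
  contDiffOn_density : ContDiffOn ℝ 1 ρ (Set.Ioc 0 R)
  contDiffOn_prad : ContDiffOn ℝ 1 prad (Set.Ioc 0 R)
  contDiffOn_ptan : ContDiffOn ℝ 1 ptan (Set.Ioc 0 R)
  /-- Hydrostatic equilibrium in the self-induced Newtonian potential `Φ`. -/
  equilibrium : ∃ Φ : ℝ → ℝ, ∀ r ∈ Set.Ioo 0 R,
    HasDerivAt Φ (mass ρ r / r ^ 2) r ∧
    HasDerivAt prad (-(2 / r) * (prad r - ptan r) - ρ r * deriv Φ r) r
  prad_pos : ∀ r ∈ Set.Ico 0 R, 0 < prad r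
  ptan_pos : ∀ r ∈ Set.Ico 0 R, 0 < ptan r
  prad_boundary : prad R = 0
  center : prad 0 = ptan 0
  vacuum : ∀ r, R < r → ρ r = 0 ∧ prad r = 0 ∧ ptan r = 0

/-- A strongly regular static self-gravitating ball of matter of radius `R`. -/
structure IsStronglyRegularBall (R : ℝ) (ρ prad ptan : ℝ → ℝ) : Prop
    extends IsRegularBall R ρ prad ptan where
  contDiffOn_density' : ContDiffOn ℝ 1 ρ (Set.Icc 0 R)
  contDiffOn_prad' : ContDiffOn ℝ 1 prad (Set.Icc 0 R)
  contDiffOn_ptan' : ContDiffOn ℝ 1 ptan (Set.Icc 0 R)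
  tendsto_deriv_density : Filter.Tendsto (deriv ρ) (𝓝[>] 0) (𝓝 0)
  tendsto_deriv_prad : Filter.Tendsto (deriv prad) (𝓝[>] 0) (𝓝 0)
  tendsto_deriv_ptan : Filter.Tendsto (deriv ptan) (𝓝[>] 0) (𝓝 0)

/-- The pressures are given by the `C¹` constitutive functions `hprad, hptan : (0,∞)² → ℝ`
evaluated at `(δ(r), η(r))`, wherever there is matter. -/
structure IsElastic (K : ℝ) (hprad hptan : ℝ → ℝ → ℝ) (ρ prad ptan : ℝ → ℝ) : Prop where
  contDiffOn_hprad :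
    ContDiffOn ℝ 1 (fun q : ℝ × ℝ => hprad q.1 q.2) (Set.Ioi 0 ×ˢ Set.Ioi 0)
  contDiffOn_hptan :
    ContDiffOn ℝ 1 (fun q : ℝ × ℝ => hptan q.1 q.2) (Set.Ioi 0 ×ˢ Set.Ioi 0)
  prad_eq : ∀ r, 0 < r → 0 < ρ r →
    prad r = hprad (normDensity K ρ r) (meanDensity K ρ r)
  ptan_eq : ∀ r, 0 < r → 0 < ρ r →
    ptan r = hptan (normDensity K ρ r) (meanDensity K ρ r)

/-- Radial constitutive function `δ² ∂_δ w` of a hyperelastic material with stored energy `w`. -/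
def hyperRad (w : ℝ → ℝ → ℝ) (δ η : ℝ) : ℝ :=
  δ ^ 2 * deriv (fun d => w d η) δ

/-- Tangential constitutive function of a hyperelastic material with stored energy `w`. -/
def hyperTan (w : ℝ → ℝ → ℝ) (δ η : ℝ) : ℝ :=
  hyperRad w δ η + 3 / 2 * δ * η * deriv (fun e => w δ e) η

/-- The John stored energy function in the variables `x = η^{1/3}`, `y = δ/η`, for Lamé
coefficients `lam, mu`. -/
def johnW (lam mu x y : ℝ) : ℝ :=
  -2 * mu * (x ^ 3)⁻¹ * y⁻¹
    + (x ^ 2)⁻¹ * (1 / 2 * (lam + 2 * mu) * (y ^ 2)⁻¹ + 2 * (lam + 2 * mu) * y⁻¹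
        + 2 * (lam + 2 * mu))
    - x⁻¹ * ((3 * lam + 4 * mu) * y⁻¹ + 2 * (3 * lam + 4 * mu))
    + 1 / 2 * (9 * lam + 10 * mu)

/-- The John stored energy function in the variables `(δ, η)`. -/
def johnEnergy (lam mu δ η : ℝ) : ℝ :=
  johnW lam mu (η ^ (1 / 3 : ℝ)) (δ / η)

/-- Radial constitutive function of the John material. -/
def johnRad (lam mu : ℝ) : ℝ → ℝ → ℝ :=
  hyperRad (johnEnergy lam mu)

/-- Tangential constitutive function of the John material. -/
def johnTan (lam mu : ℝ) : ℝ → ℝ → ℝ :=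
  hyperTan (johnEnergy lam mu)

end

end ElasticBall

namespace ElasticBall

/-! The John material is harmonic: in Lagrangian variables its equilibrium equation becomes
semilinear. Put `x = η^(1/3)`. The reference radius is `s = r x`, the tangential stretch is `u = r/s
= 1/x`, the radial stretch is `W = dr/ds = x²/δ`, and `q = W + 2u` is the trace of the deformation
gradient. With `a = λ + 2μ` and `b = 3λ + 4μ` the radial pressure is `2μ + (b - a q)/u²`, and force
balance reduces to `q' = C s / u²`, `(s u)' = q - 2u`, with `C = 4πK²/(3a)`, `u(0) = α =
(K/ρc)^(1/3) < 1` and `q(0) = 3α`.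

Existence. Since `(s³u)' = s² q`, integrating twice and exchanging the integrals gives `u(s) = α +
(C s²/3) ∫₀¹ (1 - σ³) σ / u(sσ)² dσ`. This operator keeps `u ≥ α` and is a contraction in a weighted
sup norm, so the profile is global (`exists_isLagrangianProfile`). The pressure starts positive
because `α < 1`. While it is nonnegative, `u < 1`, so `q' ≥ C s` drives it to zero at a finite
radius (`exists_radius`). Inverting `s ↦ s u(s)` and cutting off at that radius gives the ball
(`isStronglyRegularBall`). The bounds are the inequalities `α < u < 1` and `u < W`.

Uniqueness. Any regular ball yields functions of `r` solving the same system, and a weighted energy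
identifies them with the profile despite the singular center (`eq_of_eulerian`, `eq_profile`). The
radius is then the first zero of the pressure. -/

/-! ### Closed forms of the constitutive functions. -/

lemma rpow_third_pow {η : ℝ} (hη : 0 < η) : (η ^ (1 / 3 : ℝ)) ^ 3 = η := by
  rw [← Real.rpow_natCast, ← Real.rpow_mul hη.le]; norm_num

lemma johnEnergy_eq (lam mu : ℝ) {δ η : ℝ} (hδ : 0 < δ) (hη : 0 < η) :
    johnEnergy lam mu δ η = -2 * mu / δ
      + (lam + 2 * mu) * (1 / 2 * (η ^ (1 / 3 : ℝ)) ^ 4 / δ ^ 2 + 2 * η ^ (1 / 3 : ℝ) / δ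
        + 2 / (η ^ (1 / 3 : ℝ)) ^ 2)
      - (3 * lam + 4 * mu) * ((η ^ (1 / 3 : ℝ)) ^ 2 / δ + 2 / η ^ (1 / 3 : ℝ))
      + 1 / 2 * (9 * lam + 10 * mu) := by
  have hx : 0 < η ^ (1 / 3 : ℝ) := Real.rpow_pos_of_pos hη _
  have h3 := (rpow_third_pow hη).symm
  unfold johnEnergy johnW
  generalize η ^ (1 / 3 : ℝ) = x at hx h3
  subst h3
  field_simp

lemma pow_rpow_third {x : ℝ} (hx : 0 < x) : (x ^ 3) ^ (1 / 3 : ℝ) = x := by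
  rw [← Real.rpow_natCast, ← Real.rpow_mul hx.le]; norm_num

lemma hasDerivAt_rpow_third {η : ℝ} (hη : 0 < η) :
    HasDerivAt (fun e : ℝ => e ^ (1 / 3 : ℝ)) (1 / (3 * (η ^ (1 / 3 : ℝ)) ^ 2)) η := by
  have h := Real.hasDerivAt_rpow_const (x := η) (p := 1 / 3) (Or.inl hη.ne')
  convert h using 1
  rw [← Real.rpow_natCast, ← Real.rpow_mul hη.le,
    show (1 / 3 - 1 : ℝ) = -(1 / 3 * (2 : ℕ)) by norm_num, Real.rpow_neg hη.le]
  field_simp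

/-- Closed form of the radial constitutive function of the John material. -/
lemma johnRad_eq (lam mu : ℝ) {δ η : ℝ} (hδ : 0 < δ) (hη : 0 < η) :
    johnRad lam mu δ η = 2 * mu - (lam + 2 * mu) * (η ^ (1 / 3 : ℝ)) ^ 4 / δ
      - 2 * (lam + 2 * mu) * η ^ (1 / 3 : ℝ) + (3 * lam + 4 * mu) * (η ^ (1 / 3 : ℝ)) ^ 2 := by
  set x := η ^ (1 / 3 : ℝ) with hxdef
  have hev : (fun d => johnEnergy lam mu d η) =ᶠ[𝓝 δ] fun d => -2 * mu * d⁻¹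
      + (lam + 2 * mu) * (1 / 2 * x ^ 4 * (d⁻¹ * d⁻¹) + 2 * x * d⁻¹ + 2 / x ^ 2)
      - (3 * lam + 4 * mu) * (x ^ 2 * d⁻¹ + 2 / x) + 1 / 2 * (9 * lam + 10 * mu) := by
    filter_upwards [lt_mem_nhds hδ] with d hd
    rw [johnEnergy_eq lam mu hd hη, ← hxdef]
    field_simp
  have hi := hasDerivAt_inv hδ.ne'
  have hd := ((((hi.const_mul (-2 * mu)).add (((((hi.mul hi).const_mul (1 / 2 * x ^ 4)).add
    (hi.const_mul (2 * x))).add_const (2 / x ^ 2)).const_mul (lam + 2 * mu))).sub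
    (((hi.const_mul (x ^ 2)).add_const (2 / x)).const_mul (3 * lam + 4 * mu))).add_const
    (1 / 2 * (9 * lam + 10 * mu)))
  have := hev.deriv_eq.trans hd.deriv
  unfold johnRad hyperRad
  rw [this]
  field_simp
  ring

/-- Closed form of the tangential constitutive function of the John material. -/
lemma johnTan_eq (lam mu : ℝ) {δ η : ℝ} (hδ : 0 < δ) (hη : 0 < η) :
    johnTan lam mu δ η = 2 * mu - (lam + 2 * mu) * η ^ (1 / 3 : ℝ)
      - 2 * (lam + 2 * mu) * δ / (η ^ (1 / 3 : ℝ)) ^ 2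
      + (3 * lam + 4 * mu) * δ / η ^ (1 / 3 : ℝ) := by
  have hr := johnRad_eq lam mu hδ hη
  have hX := hasDerivAt_rpow_third hη
  have h3 := rpow_third_pow hη
  have hx : 0 < η ^ (1 / 3 : ℝ) := Real.rpow_pos_of_pos hη _
  have hev : (fun e => johnEnergy lam mu δ e) =ᶠ[𝓝 η] fun e => -2 * mu / δ
      + (lam + 2 * mu) * (1 / 2 / δ ^ 2 * (e ^ (1 / 3 : ℝ)) ^ 4 + 2 / δ * e ^ (1 / 3 : ℝ)
        + 2 * ((e ^ (1 / 3 : ℝ))⁻¹) ^ 2)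
      - (3 * lam + 4 * mu) * (1 / δ * (e ^ (1 / 3 : ℝ)) ^ 2 + 2 * (e ^ (1 / 3 : ℝ))⁻¹)
      + 1 / 2 * (9 * lam + 10 * mu) := by
    filter_upwards [lt_mem_nhds hη] with e he
    rw [johnEnergy_eq lam mu hδ he]
    have : 0 < e ^ (1 / 3 : ℝ) := Real.rpow_pos_of_pos he _
    field_simp
  have hi := hX.inv hx.ne'
  have hd := (((((((hX.pow 4).const_mul (1 / 2 / δ ^ 2)).add (hX.const_mul (2 / δ))).add
    ((hi.pow 2).const_mul 2)).const_mul (lam + 2 * mu)).const_add (-2 * mu / δ)).sub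
    ((((hX.pow 2).const_mul (1 / δ)).add (hi.const_mul 2)).const_mul
      (3 * lam + 4 * mu))).add_const (1 / 2 * (9 * lam + 10 * mu))
  have := hev.deriv_eq.trans hd.deriv
  change hyperTan (johnEnergy lam mu) δ η = _
  unfold hyperTan
  rw [show hyperRad (johnEnergy lam mu) δ η = johnRad lam mu δ η from rfl, hr, this]
  simp only [Pi.inv_apply]
  generalize η ^ (1 / 3 : ℝ) = x at hx h3
  subst h3
  norm_num
  field_simp
  ring

lemma deriv_johnRad (lam mu : ℝ) {δ η : ℝ} (hδ : 0 < δ) (hη : 0 < η) :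
    deriv (fun d => johnRad lam mu d η) δ
      = (lam + 2 * mu) * (η ^ (1 / 3 : ℝ)) ^ 4 / δ ^ 2 := by
  set x := η ^ (1 / 3 : ℝ) with hxdef
  have hev : (fun d => johnRad lam mu d η) =ᶠ[𝓝 δ] fun d =>
      2 * mu - (lam + 2 * mu) * x ^ 4 * d⁻¹ - 2 * (lam + 2 * mu) * x
        + (3 * lam + 4 * mu) * x ^ 2 := by
    filter_upwards [lt_mem_nhds hδ] with d hd
    rw [johnRad_eq lam mu hd hη, ← hxdef]
    ring
  have hd := (((((hasDerivAt_inv hδ.ne').const_mul ((lam + 2 * mu) * x ^ 4)).const_sub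
    (2 * mu)).sub_const (2 * (lam + 2 * mu) * x)).add_const ((3 * lam + 4 * mu) * x ^ 2))
  rw [hev.deriv_eq.trans hd.deriv]
  field_simp

lemma deriv_johnRad_pos {lam mu δ η : ℝ} (h : 0 < lam + 2 * mu) (hδ : 0 < δ) (hη : 0 < η) :
    0 < deriv (fun d => johnRad lam mu d η) δ := by
  rw [deriv_johnRad lam mu hδ hη]
  have := Real.rpow_pos_of_pos hη (1 / 3)
  positivity

lemma contDiffOn_rpow_third_snd :
    ContDiffOn ℝ 1 (fun q : ℝ × ℝ => q.2 ^ (1 / 3 : ℝ)) (Set.Ioi 0 ×ˢ Set.Ioi 0) :=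
  contDiffOn_snd.rpow_const_of_ne fun _ hq => (Set.mem_Ioi.1 hq.2).ne'

lemma contDiffOn_johnRad (lam mu : ℝ) :
    ContDiffOn ℝ 1 (fun q : ℝ × ℝ => johnRad lam mu q.1 q.2) (Set.Ioi 0 ×ˢ Set.Ioi 0) := by
  have hX := contDiffOn_rpow_third_snd
  have h1 : ContDiffOn ℝ 1 (fun q : ℝ × ℝ => q.1) (Set.Ioi 0 ×ˢ Set.Ioi 0) := contDiffOn_fst
  refine ContDiffOn.congr ?_ fun q hq => johnRad_eq lam mu hq.1 hq.2
  exact ((contDiffOn_const.sub ((contDiffOn_const.mul (hX.pow 4)).div h1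
    fun q hq => (Set.mem_Ioi.1 hq.1).ne')).sub (contDiffOn_const.mul hX)).add
    (contDiffOn_const.mul (hX.pow 2))

lemma contDiffOn_johnTan (lam mu : ℝ) :
    ContDiffOn ℝ 1 (fun q : ℝ × ℝ => johnTan lam mu q.1 q.2) (Set.Ioi 0 ×ˢ Set.Ioi 0) := by
  have hX := contDiffOn_rpow_third_snd
  have h0 : ∀ q ∈ (Set.Ioi (0 : ℝ) ×ˢ Set.Ioi (0 : ℝ)), q.2 ^ (1 / 3 : ℝ) ≠ 0 :=
    fun q hq => (Real.rpow_pos_of_pos hq.2 _).ne'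
  have h1 : ContDiffOn ℝ 1 (fun q : ℝ × ℝ => q.1) (Set.Ioi 0 ×ˢ Set.Ioi 0) := contDiffOn_fst
  refine ContDiffOn.congr ?_ fun q hq => johnTan_eq lam mu hq.1 hq.2
  exact ((contDiffOn_const.sub (contDiffOn_const.mul hX)).sub
    ((contDiffOn_const.mul h1).div (hX.pow 2) fun q hq => pow_ne_zero 2 (h0 q hq))).add
    ((contDiffOn_const.mul h1).div hX h0)

/-! ### Global existence of Lagrangian profiles by a weighted contraction. -/

/-- The Lagrangian form of the equilibrium equations: `s` is the radius in the reference
configuration, `s * u s` the radius in the deformed one, and `q` the trace of the deformation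
gradient. -/
structure IsLagrangianProfile (C α : ℝ) (u u' q : ℝ → ℝ) : Prop where
  le_u : ∀ s, α ≤ u s
  u_zero : u 0 = α
  q_zero : q 0 = 3 * α
  hasDerivAt_u : ∀ s, HasDerivAt u (u' s) s
  hasDerivAt_q : ∀ s, HasDerivAt q (C * s / u s ^ 2) s
  continuous_u' : Continuous u'
  mul_u' : ∀ s, s * u' s = q s - 3 * u s
  le_q : ∀ s, 3 * u s ≤ q s
  u'_zero : u' 0 = 0
  u'_pos : ∀ s, 0 < s → 0 < u' s

lemma continuous_integral_comp_mul {g f : ℝ → ℝ} (hg : Continuous g) (hf : Continuous f) :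
    Continuous fun s => ∫ σ in (0 : ℝ)..1, g σ * f (s * σ) := by
  apply intervalIntegral.continuous_parametric_intervalIntegral_of_continuous'
  fun_prop

/-- Averages `s^(-n-1) ∫₀ˢ tⁿ f` are thereby written as parametric integrals over `[0, 1]`, which
stay continuous at `s = 0`. -/
lemma pow_mul_integral_comp_mul (n : ℕ) (f : ℝ → ℝ) (s : ℝ) :
    s ^ (n + 1) * ∫ σ in (0 : ℝ)..1, σ ^ n * f (s * σ) = ∫ t in (0 : ℝ)..s, t ^ n * f t := by
  have h := intervalIntegral.smul_integral_comp_mul_left (a := 0) (b := 1)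
    (fun t => t ^ n * f t) s
  simp only [smul_eq_mul, mul_zero, mul_one] at h
  rw [← h, pow_succ', mul_assoc, ← intervalIntegral.integral_const_mul]
  congr 1
  apply intervalIntegral.integral_congr
  intro σ _
  simp only
  ring

lemma abs_inv_sq_sub_inv_sq_le {α p q : ℝ} (hα : 0 < α) (hp : α ≤ p) (hq : α ≤ q) :
    |1 / p ^ 2 - 1 / q ^ 2| ≤ 2 / α ^ 3 * |p - q| := by
  have hp0 := hα.trans_le hp
  have hq0 := hα.trans_le hq
  have e : 1 / p ^ 2 - 1 / q ^ 2 = -(1 / (p * q ^ 2) + 1 / (p ^ 2 * q)) * (p - q) := by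
    field_simp; ring
  have h1 : 1 / (p * q ^ 2) ≤ 1 / α ^ 3 := by
    apply one_div_le_one_div_of_le (by positivity)
    calc α ^ 3 = α * α ^ 2 := by ring
      _ ≤ p * q ^ 2 := by gcongr
  have h2 : 1 / (p ^ 2 * q) ≤ 1 / α ^ 3 := by
    apply one_div_le_one_div_of_le (by positivity)
    calc α ^ 3 = α ^ 2 * α := by ring
      _ ≤ p ^ 2 * q := by gcongr
  rw [e, abs_mul, abs_neg, abs_of_pos (by positivity)]
  gcongr
  calc _ ≤ 1 / α ^ 3 + 1 / α ^ 3 := add_le_add h1 h2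
    _ = 2 / α ^ 3 := by ring

/-- The gravitational source term, truncated so as to be globally Lipschitz. -/
noncomputable def truncSource (α y : ℝ) : ℝ := 1 / max y α ^ 2

lemma continuous_truncSource {α : ℝ} (hα : 0 < α) : Continuous (truncSource α) := by
  unfold truncSource
  refine continuous_const.div (by fun_prop) fun y => ?_
  have := hα.trans_le (le_max_right y α)
  positivity

lemma truncSource_pos {α : ℝ} (hα : 0 < α) (y : ℝ) : 0 < truncSource α y := by
  unfold truncSource
  have := hα.trans_le (le_max_right y α)
  positivity

lemma truncSource_le {α : ℝ} (hα : 0 < α) (y : ℝ) : truncSource α y ≤ 1 / α ^ 2 := by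
  unfold truncSource
  have := le_max_right y α
  gcongr

lemma abs_truncSource_sub_le {α : ℝ} (hα : 0 < α) (y z : ℝ) :
    |truncSource α y - truncSource α z| ≤ 2 / α ^ 3 * |y - z| := by
  refine (abs_inv_sq_sub_inv_sq_le hα (le_max_right y α) (le_max_right z α)).trans ?_
  exact mul_le_mul_of_nonneg_left (abs_max_sub_max_le_abs y z α) (by positivity)

/-- The integral operator whose fixed points are the Lagrangian profiles. -/
noncomputable def profileOp (C α : ℝ) (w : ℝ → ℝ) (s : ℝ) : ℝ :=
  α + C * s ^ 2 / 3 * ∫ σ in (0 : ℝ)..1, ((1 - σ ^ 3) * σ) * truncSource α (w (s * σ))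

lemma continuous_profileOp {C α : ℝ} (hα : 0 < α) {w : ℝ → ℝ} (hw : Continuous w) :
    Continuous (profileOp C α w) := by
  unfold profileOp
  have := continuous_integral_comp_mul (g := fun σ => (1 - σ ^ 3) * σ) (by fun_prop)
    ((continuous_truncSource hα).comp hw)
  simp only [Function.comp_def] at this
  fun_prop

lemma kernel_nonneg {σ : ℝ} (h : σ ∈ Set.Icc (0 : ℝ) 1) : 0 ≤ (1 - σ ^ 3) * σ :=
  mul_nonneg (sub_nonneg.2 (pow_le_one₀ h.1 h.2)) h.1

lemma kernel_le {σ : ℝ} (h : σ ∈ Set.Icc (0 : ℝ) 1) : (1 - σ ^ 3) * σ ≤ σ := by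
  have := pow_nonneg h.1 4
  nlinarith

lemma le_profileOp {C α : ℝ} (hC : 0 < C) (hα : 0 < α) (w : ℝ → ℝ) (s : ℝ) :
    α ≤ profileOp C α w s := by
  unfold profileOp
  have hI : 0 ≤ ∫ σ in (0 : ℝ)..1, ((1 - σ ^ 3) * σ) * truncSource α (w (s * σ)) :=
    intervalIntegral.integral_nonneg zero_le_one fun σ h =>
      mul_nonneg (kernel_nonneg h) (truncSource_pos hα _).le
  have : 0 ≤ C * s ^ 2 / 3 := by positivity
  linarith [mul_nonneg this hI]

lemma profileOp_le {C α : ℝ} (hC : 0 < C) (hα : 0 < α) {w : ℝ → ℝ} (hw : Continuous w) (s : ℝ) :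
    profileOp C α w s ≤ α + C * s ^ 2 / 3 * (1 / α ^ 2) := by
  unfold profileOp
  gcongr
  have hc : Continuous fun σ : ℝ => truncSource α (w (s * σ)) :=
    (continuous_truncSource hα).comp (hw.comp (by fun_prop))
  have : ∫ σ in (0 : ℝ)..1, ((1 - σ ^ 3) * σ) * truncSource α (w (s * σ))
      ≤ ∫ _ in (0 : ℝ)..1, 1 / α ^ 2 := by
    apply intervalIntegral.integral_mono_on zero_le_one
    · exact (Continuous.mul (by fun_prop) hc).intervalIntegrable _ _
    · exact continuous_const.intervalIntegrable _ _
    intro σ h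
    calc _ ≤ 1 * truncSource α (w (s * σ)) := by
          gcongr
          · exact (truncSource_pos hα _).le
          · exact (kernel_le h).trans h.2
      _ ≤ _ := by rw [one_mul]; exact truncSource_le hα _
  simpa using this

/-- The weight `exp (L s²)` is chosen for this: the factor `s²` in `profileOp` is absorbed exactly,
at the gain of `1 / (2L)`. -/
lemma sq_mul_integral_exp {L : ℝ} (hL : 0 < L) (s : ℝ) :
    s ^ 2 * ∫ σ in (0 : ℝ)..1, σ * Real.exp (L * (s * σ) ^ 2)
      = (Real.exp (L * s ^ 2) - 1) / (2 * L) := by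
  have hd : ∀ σ ∈ Set.uIcc (0 : ℝ) 1, HasDerivAt
      (fun σ => Real.exp (L * (s * σ) ^ 2) / (2 * L))
      (s ^ 2 * (σ * Real.exp (L * (s * σ) ^ 2))) σ := by
    intro σ _
    have h := ((((((hasDerivAt_id σ).const_mul s).pow 2).const_mul L).exp).div_const (2 * L))
    refine h.congr_deriv ?_
    simp
    field_simp
  have hi := intervalIntegral.integral_eq_sub_of_hasDerivAt hd
    (Continuous.intervalIntegrable (by fun_prop) _ _)
  rw [← intervalIntegral.integral_const_mul, hi]
  simp
  ring

/-- The constant is the product of the prefactor `C / 3`, the Lipschitz constant `2 / α³` of the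
source and the gain `1 / (2L)`; the kernel is bounded by `σ`. -/
lemma abs_profileOp_sub_le {C α L B : ℝ} (hC : 0 < C) (hα : 0 < α) (hL : 0 < L) (hB : 0 ≤ B)
    {w z : ℝ → ℝ} (hw : Continuous w) (hz : Continuous z)
    (h : ∀ s, |w s - z s| ≤ B * Real.exp (L * s ^ 2)) (s : ℝ) :
    |profileOp C α w s - profileOp C α z s|
      ≤ C / (3 * α ^ 3 * L) * B * Real.exp (L * s ^ 2) := by
  have hcw : Continuous fun σ : ℝ => truncSource α (w (s * σ)) :=
    (continuous_truncSource hα).comp (hw.comp (by fun_prop))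
  have hcz : Continuous fun σ : ℝ => truncSource α (z (s * σ)) :=
    (continuous_truncSource hα).comp (hz.comp (by fun_prop))
  have hint : |∫ σ in (0 : ℝ)..1, ((1 - σ ^ 3) * σ) *
        (truncSource α (w (s * σ)) - truncSource α (z (s * σ)))|
      ≤ ∫ σ in (0 : ℝ)..1, 2 / α ^ 3 * B * (σ * Real.exp (L * (s * σ) ^ 2)) := by
    refine (intervalIntegral.abs_integral_le_integral_abs zero_le_one).trans ?_
    apply intervalIntegral.integral_mono_on zero_le_one
    · exact (Continuous.mul (by fun_prop) (hcw.sub hcz)).abs.intervalIntegrable _ _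
    · exact Continuous.intervalIntegrable (by fun_prop) _ _
    intro σ hσ
    rw [abs_mul, abs_of_nonneg (kernel_nonneg hσ)]
    calc _ ≤ σ * (2 / α ^ 3 * (B * Real.exp (L * (s * σ) ^ 2))) := by
          apply mul_le_mul (kernel_le hσ) _ (abs_nonneg _) hσ.1
          refine (abs_truncSource_sub_le hα _ _).trans ?_
          gcongr
          exact h _
      _ = _ := by ring
  have e : profileOp C α w s - profileOp C α z s = C * s ^ 2 / 3 *
      ∫ σ in (0 : ℝ)..1, ((1 - σ ^ 3) * σ) *
        (truncSource α (w (s * σ)) - truncSource α (z (s * σ))) := by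
    unfold profileOp
    simp only [mul_sub]
    rw [intervalIntegral.integral_sub]
    · ring
    · exact (Continuous.mul (by fun_prop) hcw).intervalIntegrable _ _
    · exact (Continuous.mul (by fun_prop) hcz).intervalIntegrable _ _
  rw [e, abs_mul, abs_of_nonneg (by positivity)]
  rw [intervalIntegral.integral_const_mul] at hint
  calc _ ≤ C * s ^ 2 / 3 *
        (2 / α ^ 3 * B * ∫ σ in (0 : ℝ)..1, σ * Real.exp (L * (s * σ) ^ 2)) := by gcongr
    _ = C / 3 * (2 / α ^ 3 * B) *
        (s ^ 2 * ∫ σ in (0 : ℝ)..1, σ * Real.exp (L * (s * σ) ^ 2)) := by ring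
    _ = C / (3 * α ^ 3 * L) * B * (Real.exp (L * s ^ 2) - 1) := by
        rw [sq_mul_integral_exp hL]; field_simp
    _ ≤ _ := by gcongr; linarith

open BoundedContinuousFunction in
lemma exists_profileOp_fixedPoint {C α : ℝ} (hC : 0 < C) (hα : 0 < α) :
    ∃ w : ℝ → ℝ, Continuous w ∧ ∀ s, profileOp C α w s = w s := by
  -- This `L` makes the Lipschitz constant `C / (3 α³ L)` equal to `1 / 2`.
  set L : ℝ := 2 * C / (3 * α ^ 3) with hLdef
  have hL : 0 < L := by positivity
  -- Writing `w = exp (L s²) v` turns the weighted sup norm of `w` into the ordinary one of the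
  -- bounded function `v`.
  set lift : (ℝ →ᵇ ℝ) → ℝ → ℝ := fun v s => Real.exp (L * s ^ 2) * v s with hlift
  have hcl : ∀ v, Continuous (lift v) := fun v => by
    have := v.continuous
    simp only [hlift]; fun_prop
  have hbd : ∀ v s, ‖Real.exp (-(L * s ^ 2)) * profileOp C α (lift v) s‖
      ≤ α + C / (3 * α ^ 2 * L) := by
    intro v s
    have h0 := hα.le.trans (le_profileOp hC hα (lift v) s)
    rw [Real.norm_eq_abs, abs_of_nonneg (by positivity)]
    have h1 := profileOp_le hC hα (hcl v) s
    have he : Real.exp (-(L * s ^ 2)) * (L * s ^ 2) ≤ 1 := by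
      have := Real.add_one_le_exp (L * s ^ 2)
      rw [Real.exp_neg, inv_mul_le_iff₀ (Real.exp_pos _)]
      linarith
    have he1 : Real.exp (-(L * s ^ 2)) ≤ 1 := Real.exp_le_one_iff.2 (by
      have : 0 ≤ L * s ^ 2 := by positivity
      linarith)
    calc _ ≤ Real.exp (-(L * s ^ 2)) * (α + C * s ^ 2 / 3 * (1 / α ^ 2)) := by gcongr
      _ = Real.exp (-(L * s ^ 2)) * α +
          C / (3 * α ^ 2 * L) * (Real.exp (-(L * s ^ 2)) * (L * s ^ 2)) := by
          field_simp
      _ ≤ 1 * α + C / (3 * α ^ 2 * L) * 1 := by gcongr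
      _ = _ := by ring
  have hcont : ∀ v, Continuous fun s => Real.exp (-(L * s ^ 2)) * profileOp C α (lift v) s := by
    intro v
    have := continuous_profileOp (C := C) hα (hcl v)
    fun_prop
  let Ψ : (ℝ →ᵇ ℝ) → (ℝ →ᵇ ℝ) := fun v =>
    BoundedContinuousFunction.ofNormedAddCommGroup _ (hcont v) _ (hbd v)
  have hΨ : ∀ v s, Ψ v s = Real.exp (-(L * s ^ 2)) * profileOp C α (lift v) s := fun _ _ => rfl
  have hcontr : ContractingWith (1 / 2) Ψ := by
    refine ⟨by norm_num, LipschitzWith.of_dist_le_mul fun v z => ?_⟩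
    rw [dist_le (by positivity)]
    intro s
    have hd : ∀ t, |lift v t - lift z t| ≤ dist v z * Real.exp (L * t ^ 2) := by
      intro t
      have := dist_coe_le_dist (f := v) (g := z) t
      rw [Real.dist_eq] at this
      simp only [hlift]
      rw [← mul_sub, abs_mul, abs_of_pos (Real.exp_pos _), mul_comm]
      gcongr
    have := abs_profileOp_sub_le hC hα hL dist_nonneg (hcl v) (hcl z) hd s
    rw [Real.dist_eq, hΨ, hΨ, ← mul_sub, abs_mul, abs_of_pos (Real.exp_pos _)]
    calc _ ≤ Real.exp (-(L * s ^ 2)) *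
          (C / (3 * α ^ 3 * L) * dist v z * Real.exp (L * s ^ 2)) := by gcongr
      _ = C / (3 * α ^ 3 * L) * dist v z *
          (Real.exp (-(L * s ^ 2)) * Real.exp (L * s ^ 2)) := by ring
      _ = _ := by
          rw [← Real.exp_add, neg_add_cancel, Real.exp_zero, mul_one, hLdef]
          push_cast
          field_simp
  obtain ⟨v, hv, -⟩ := hcontr.exists_fixedPoint 0 (edist_ne_top _ _)
  refine ⟨lift v, hcl v, fun s => ?_⟩
  have h := hΨ v s
  rw [hv.eq] at h
  simp only [hlift] at h ⊢
  rw [h, ← mul_assoc, ← Real.exp_add, add_neg_cancel, Real.exp_zero, one_mul]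

/-- Global existence of Lagrangian profiles. -/
theorem exists_isLagrangianProfile {C α : ℝ} (hC : 0 < C) (hα : 0 < α) :
    ∃ u u' q : ℝ → ℝ, IsLagrangianProfile C α u u' q := by
  obtain ⟨w, hw, hfix⟩ := exists_profileOp_fixedPoint hC hα
  have hle : ∀ s, α ≤ w s := fun s => (hfix s) ▸ le_profileOp hC hα w s
  set f : ℝ → ℝ := fun t => truncSource α (w t) with hf
  have hfc : Continuous f := (continuous_truncSource hα).comp hw
  -- The truncation is inactive at a fixed point, which lies above `α`.
  have hfw : ∀ t, f t = 1 / w t ^ 2 := fun t => by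
    simp only [hf, truncSource, max_eq_left (hle t)]
  have hfp : ∀ t, 0 < f t := fun t => truncSource_pos hα _
  set I1 : ℝ → ℝ := fun s => ∫ σ in (0 : ℝ)..1, σ ^ 1 * f (s * σ) with hI1
  set I4 : ℝ → ℝ := fun s => ∫ σ in (0 : ℝ)..1, σ ^ 4 * f (s * σ) with hI4
  have hI4c : Continuous I4 := continuous_integral_comp_mul (by fun_prop) hfc
  have hI4p : ∀ s, 0 < I4 s := by
    intro s
    apply intervalIntegral.intervalIntegral_pos_of_pos_on
    · exact (Continuous.mul (by fun_prop) (hfc.comp (by fun_prop))).intervalIntegrable _ _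
    · intro σ hσ
      exact mul_pos (pow_pos hσ.1 4) (hfp _)
    · exact one_pos
  set A : ℝ → ℝ := fun s => ∫ t in (0 : ℝ)..s, t ^ 1 * f t with hA
  set B : ℝ → ℝ := fun s => ∫ t in (0 : ℝ)..s, t ^ 4 * f t with hB
  have hAI : ∀ s, s ^ 2 * I1 s = A s := fun s => pow_mul_integral_comp_mul 1 f s
  have hBI : ∀ s, s ^ 5 * I4 s = B s := fun s => pow_mul_integral_comp_mul 4 f s
  have hA' : ∀ s, HasDerivAt A (s ^ 1 * f s) s := fun s =>
    (Continuous.mul (by fun_prop) hfc : Continuous fun t => t ^ 1 * f t).integral_hasStrictDerivAt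
      0 s |>.hasDerivAt
  have hB' : ∀ s, HasDerivAt B (s ^ 4 * f s) s := fun s =>
    (Continuous.mul (by fun_prop) hfc : Continuous fun t => t ^ 4 * f t).integral_hasStrictDerivAt
      0 s |>.hasDerivAt
  have hwI : ∀ s, w s = α + C / 3 * (s ^ 2 * I1 s - s ^ 2 * I4 s) := by
    intro s
    have : ∫ σ in (0 : ℝ)..1, ((1 - σ ^ 3) * σ) * f (s * σ) = I1 s - I4 s := by
      rw [hI1, hI4]
      simp only
      rw [← intervalIntegral.integral_sub]
      · congr 1; ext σ; ring
      · exact (Continuous.mul (by fun_prop) (hfc.comp (by fun_prop))).intervalIntegrable _ _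
      · exact (Continuous.mul (by fun_prop) (hfc.comp (by fun_prop))).intervalIntegrable _ _
    rw [← hfix s, profileOp, this]
    ring
  -- Differentiating `w = α + C/3 (A - B/s³)`, the terms in `f` cancel and `C B / s⁴ = C s I4`
  -- remains; written with `I4`, it is continuous at the center.
  refine ⟨w, fun s => C * s * I4 s, fun s => 3 * α + C * A s, hle, ?_, ?_, ?_, ?_, by fun_prop,
    ?_, ?_, by simp, fun s hs => ?_⟩
  · rw [hwI 0]; simp
  · simp [hA]
  · have hne : ∀ s, s ≠ 0 → HasDerivAt w (C * s * I4 s) s := by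
      intro s hs
      have hev : w =ᶠ[𝓝 s] fun t => α + C / 3 * (A t - B t / t ^ 3) := by
        filter_upwards [isOpen_ne.mem_nhds hs] with t ht
        rw [hwI t, hAI, ← hBI]
        have : t ≠ 0 := ht
        field_simp
      have h := ((((hA' s).sub ((hB' s).div (hasDerivAt_pow 3 s) (pow_ne_zero 3 hs))).const_mul
        (C / 3)).const_add α).congr_of_eventuallyEq hev
      refine h.congr_deriv ?_
      rw [← hBI]
      norm_num
      field_simp
      ring
    intro s
    rcases eq_or_ne s 0 with rfl | hs
    -- At the center the derivative is the limit of the derivatives nearby.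
    · exact hasDerivAt_of_hasDerivAt_of_ne (g := fun s => C * s * I4 s) (fun y hy => hne y hy)
        hw.continuousAt (by fun_prop)
    · exact hne s hs
  · intro s
    refine (((hA' s).const_mul C).const_add (3 * α)).congr_deriv ?_
    rw [hfw]; ring
  · intro s
    simp only [← hAI]
    rw [hwI s]; ring
  · intro s
    simp only [← hAI]
    have := mul_nonneg hC.le (mul_nonneg (sq_nonneg s) (hI4p s).le)
    rw [hwI s]; linarith
  · have := hI4p s
    positivity

lemma contDiff_one_of_hasDerivAt {f f' : ℝ → ℝ} (hf : ∀ x, HasDerivAt f (f' x) x)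
    (hf' : Continuous f') : ContDiff ℝ 1 f := by
  rw [contDiff_one_iff_deriv]
  refine ⟨fun x => (hf x).differentiableAt, ?_⟩
  rwa [show deriv f = f' from funext fun x => (hf x).deriv]

/-! ### Monotonicity, inversion and finite radius of Lagrangian profiles. -/

namespace IsLagrangianProfile

variable {C α : ℝ} {u u' q : ℝ → ℝ}

lemma u_pos (h : IsLagrangianProfile C α u u' q) (hα : 0 < α) (s : ℝ) : 0 < u s :=
  hα.trans_le (h.le_u s)

lemma lt_u (h : IsLagrangianProfile C α u u' q) {s : ℝ} (hs : 0 < s) : α < u s := by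
  have hm : StrictMonoOn u (Set.Ici 0) := by
    apply strictMonoOn_of_deriv_pos (convex_Ici 0)
    · exact fun x _ => (h.hasDerivAt_u x).continuousAt.continuousWithinAt
    · intro x hx
      rw [interior_Ici] at hx
      rw [(h.hasDerivAt_u x).deriv]
      exact h.u'_pos x hx
  rw [← h.u_zero]
  exact hm Set.self_mem_Ici hs.le hs

lemma lt_q (h : IsLagrangianProfile C α u u' q) {s : ℝ} (hs : 0 < s) : 3 * u s < q s := by
  have := h.mul_u' s
  have := mul_pos hs (h.u'_pos s hs)
  linarith

lemma continuous_u (h : IsLagrangianProfile C α u u' q) : Continuous u :=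
  continuous_iff_continuousAt.2 fun s => (h.hasDerivAt_u s).continuousAt

lemma continuous_q (h : IsLagrangianProfile C α u u' q) : Continuous q :=
  continuous_iff_continuousAt.2 fun s => (h.hasDerivAt_q s).continuousAt

lemma hasDerivAt_radius (h : IsLagrangianProfile C α u u' q) (s : ℝ) :
    HasDerivAt (fun s => s * u s) (q s - 2 * u s) s := by
  refine ((hasDerivAt_id s).mul (h.hasDerivAt_u s)).congr_deriv ?_
  have := h.mul_u' s
  simp only [id]
  linarith

/-- This is the radial stretch `d(s u)/ds`; it is at least `u`. -/
lemma stretch_pos (h : IsLagrangianProfile C α u u' q) (hα : 0 < α) (s : ℝ) :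
    0 < q s - 2 * u s := by
  have := h.le_q s
  have := h.u_pos hα s
  linarith

/-- The deformed radius is an invertible function of the reference radius. -/
lemma exists_inverse (h : IsLagrangianProfile C α u u' q) (hα : 0 < α) :
    ∃ S : ℝ → ℝ, StrictMono S ∧ (∀ r, S r * u (S r) = r) ∧ (∀ s, S (s * u s) = s) ∧
      ∀ r, HasDerivAt S (1 / (q (S r) - 2 * u (S r))) r := by
  have hmono : StrictMono fun s => s * u s :=
    strictMono_of_deriv_pos fun s => by
      rw [(h.hasDerivAt_radius s).deriv]; exact h.stretch_pos hα s
  have hcont : Continuous fun s => s * u s := continuous_id.mul h.continuous_u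
  have htop : Filter.Tendsto (fun s => s * u s) Filter.atTop Filter.atTop := by
    apply Filter.tendsto_atTop_mono' _ _ (Filter.tendsto_id.atTop_mul_const hα)
    filter_upwards [Filter.eventually_ge_atTop 0] with s hs
    exact mul_le_mul_of_nonneg_left (h.le_u s) hs
  have hbot : Filter.Tendsto (fun s => s * u s) Filter.atBot Filter.atBot := by
    apply Filter.tendsto_atBot_mono' _ _ (Filter.tendsto_id.atBot_mul_const hα)
    filter_upwards [Filter.eventually_le_atBot 0] with s hs
    exact mul_le_mul_of_nonpos_left (h.le_u s) hs
  let e := hmono.orderIsoOfSurjective _ (hcont.surjective htop hbot)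
  have he : ∀ s, e s = s * u s := fun _ => rfl
  have h1 : ∀ r, e.symm r * u (e.symm r) = r := fun r => e.apply_symm_apply r
  refine ⟨e.symm, e.symm.strictMono, h1, fun s => e.symm_apply_apply s, fun r => ?_⟩
  rw [one_div]
  exact HasDerivAt.of_local_left_inverse e.symm.continuous.continuousAt
    (h.hasDerivAt_radius _) (h.stretch_pos hα _).ne' (Filter.Eventually.of_forall h1)

/-- The radial pressure vanishes at some finite reference radius. -/
lemma exists_radius (h : IsLagrangianProfile C α u u' q) (hC : 0 < C) (hα : 0 < α) (hα1 : α < 1)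
    {lam mu : ℝ} (hmu : 0 ≤ mu) (hbulk : 0 < 3 * lam + 2 * mu) :
    ∃ s₀, 0 < s₀ ∧
      2 * mu * u s₀ ^ 2 + (3 * lam + 4 * mu) - (lam + 2 * mu) * q s₀ = 0 ∧
      (∀ s ∈ Set.Ico 0 s₀,
        0 < 2 * mu * u s ^ 2 + (3 * lam + 4 * mu) - (lam + 2 * mu) * q s) ∧
      ∀ s ∈ Set.Icc 0 s₀, u s < 1 := by
  have ha : 0 < lam + 2 * mu := by linarith
  -- `G` is `u²` times the radial pressure, hence has its sign.
  set G : ℝ → ℝ := fun s => 2 * mu * u s ^ 2 + (3 * lam + 4 * mu) - (lam + 2 * mu) * q s with hG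
  have hGc : Continuous G := by
    have := h.continuous_u
    have := h.continuous_q
    fun_prop
  have hG0 : 0 < G 0 := by
    have : G 0 = (1 - α) * (3 * lam + 2 * mu + 2 * mu * (1 - α)) := by
      simp only [hG, h.u_zero, h.q_zero]; ring
    rw [this]
    have : 0 < 1 - α := by linarith
    positivity
  -- If `u` reached `1`, then `q > 3` there, and `G < 2μ + (3λ + 4μ) - 3(λ + 2μ) = 0`.
  have hlt : ∀ S, (∀ s ∈ Set.Icc 0 S, 0 ≤ G s) → ∀ s ∈ Set.Icc 0 S, u s < 1 := by
    intro S hS s hs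
    by_contra! hc
    obtain ⟨t, ht, htu⟩ := intermediate_value_Icc hs.1 h.continuous_u.continuousOn
      (show (1 : ℝ) ∈ Set.Icc (u 0) (u s) from ⟨by rw [h.u_zero]; exact hα1.le, hc⟩)
    have ht0 : 0 < t := by
      rcases ht.1.eq_or_lt with h0 | h0
      · rw [← h0, h.u_zero] at htu; linarith
      · exact h0
    have h1 := hS t ⟨ht.1, ht.2.trans hs.2⟩
    have h2 := h.lt_q ht0
    simp only [hG, htu] at h1
    rw [htu] at h2
    nlinarith
  have hex : ∃ s, 0 ≤ s ∧ G s ≤ 0 := by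
    by_contra! hc
    have hu1 : ∀ s, 0 ≤ s → u s < 1 := fun s hs =>
      hlt s (fun t ht => (hc t ht.1).le) s ⟨hs, le_rfl⟩
    -- `u < 1` makes `q' ≥ C s`, so `q` grows at least like `C s² / 2`.
    have hq : MonotoneOn (fun s => q s - C / 2 * s ^ 2) (Set.Ici 0) := by
      have hd : ∀ s, HasDerivAt (fun s => q s - C / 2 * s ^ 2) (C * s / u s ^ 2 - C * s) s := by
        intro s
        refine ((h.hasDerivAt_q s).sub ((hasDerivAt_pow 2 s).const_mul (C / 2))).congr_deriv ?_
        norm_num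
        ring
      apply monotoneOn_of_deriv_nonneg (convex_Ici 0)
      · exact fun x _ => (hd x).continuousAt.continuousWithinAt
      · exact fun x _ => (hd x).differentiableAt.differentiableWithinAt
      · intro s hs
        rw [interior_Ici] at hs
        rw [(hd s).deriv, sub_nonneg]
        have h0 := h.u_pos hα s
        have h1 := hu1 s hs.le
        have : 0 < C * s := mul_pos hC hs
        rw [le_div_iff₀ (by positivity)]
        have : u s ^ 2 ≤ 1 := pow_le_one₀ h0.le h1.le
        nlinarith
    -- As `u < 1`, `G > 0` would force `q < M`; this fails at `s = √(2M/C)`, where `C s² / 2 = M`.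
    set M := (2 * mu + (3 * lam + 4 * mu)) / (lam + 2 * mu) with hM
    have hM0 : 0 < M := by
      have : 0 < 2 * mu + (3 * lam + 4 * mu) := by linarith
      positivity
    have hs0 := Real.sqrt_nonneg (2 * M / C)
    have h1 := hq Set.self_mem_Ici hs0 hs0
    have h2 := hc _ hs0
    have h3 := hu1 _ hs0
    simp only [h.q_zero, Real.sq_sqrt (show 0 ≤ 2 * M / C by positivity)] at h1
    simp only [hG] at h2
    set x := √(2 * M / C)
    have h4 : u x ^ 2 ≤ 1 := pow_le_one₀ (h.u_pos hα x).le h3.le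
    have h5 : C / 2 * (2 * M / C) = M := by field_simp
    rw [h5] at h1
    have h6 : M ≤ q x := by nlinarith
    have h7 : (lam + 2 * mu) * M = 2 * mu + (3 * lam + 4 * mu) := by
      rw [hM]; field_simp
    nlinarith [mul_le_mul_of_nonneg_left h6 ha.le, mul_le_mul_of_nonneg_left h4 hmu]
  -- The radius is the first point with `G ≤ 0`; by continuity `G` vanishes there.
  set Z : Set ℝ := {s | 0 ≤ s ∧ G s ≤ 0} with hZ
  have hZc : IsClosed Z :=
    (isClosed_le continuous_const continuous_id).inter (isClosed_le hGc continuous_const)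
  have hZb : BddBelow Z := ⟨0, fun s hs => hs.1⟩
  have hmem : sInf Z ∈ Z := hZc.csInf_mem hex hZb
  set s₀ := sInf Z
  have hpos : ∀ s ∈ Set.Ico 0 s₀, 0 < G s := by
    intro s hs
    by_contra! hc
    exact absurd (csInf_le hZb (show s ∈ Z from ⟨hs.1, hc⟩)) (not_le.2 hs.2)
  have hs₀ : 0 < s₀ := by
    rcases hmem.1.eq_or_lt with h0 | h0
    · have := hmem.2
      rw [← h0] at this
      linarith
    · exact h0
  have hzero : G s₀ = 0 := by
    refine le_antisymm hmem.2 ?_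
    have hcl : s₀ ∈ closure (Set.Ico 0 s₀) := by
      rw [closure_Ico hs₀.ne]; exact ⟨hs₀.le, le_rfl⟩
    exact closure_minimal (fun s hs => (hpos s hs).le) (isClosed_le continuous_const hGc) hcl
  refine ⟨s₀, hs₀, hzero, hpos, hlt s₀ fun s hs => ?_⟩
  rcases hs.2.eq_or_lt with h0 | h0
  · rw [h0, hzero]
  · exact (hpos s ⟨hs.1, h0⟩).le

end IsLagrangianProfile

/-! ### Passage to the deformed radius. -/

/-- A Lagrangian profile in terms of the deformed radius `r`: `S` is the reference radius, and
`U`, `V` are the profile functions `u`, `q` along `S`. -/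
structure IsEulerianProfile (C α : ℝ) (S U U' V : ℝ → ℝ) : Prop where
  strictMono_S : StrictMono S
  S_mul_U : ∀ r, S r * U r = r
  le_U : ∀ r, α ≤ U r
  le_V : ∀ r, 3 * U r ≤ V r
  U_zero : U 0 = α
  V_zero : V 0 = 3 * α
  hasDerivAt_S : ∀ r, HasDerivAt S (1 / (V r - 2 * U r)) r
  hasDerivAt_U : ∀ r, HasDerivAt U (U' r) r
  hasDerivAt_V : ∀ r, HasDerivAt V (C * S r / (U r ^ 2 * (V r - 2 * U r))) r
  continuous_U' : Continuous U'
  U'_zero : U' 0 = 0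
  mul_U' : ∀ r, r * U' r = (V r - 3 * U r) * U r / (V r - 2 * U r)
  lt_U : ∀ r, 0 < r → α < U r
  lt_V : ∀ r, 0 < r → 3 * U r < V r

lemma IsLagrangianProfile.isEulerianProfile {C α : ℝ} {u u' q S : ℝ → ℝ}
    (h : IsLagrangianProfile C α u u' q) (hα : 0 < α) (hS : StrictMono S)
    (hSu : ∀ r, S r * u (S r) = r)
    (hS' : ∀ r, HasDerivAt S (1 / (q (S r) - 2 * u (S r))) r) :
    IsEulerianProfile C α S (fun r => u (S r))
      (fun r => u' (S r) * (1 / (q (S r) - 2 * u (S r)))) (fun r => q (S r)) := by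
  have hS0 : S 0 = 0 := by
    have := hSu 0
    rcases mul_eq_zero.1 this with h0 | h0
    · exact h0
    · exact absurd h0 (h.u_pos hα _).ne'
  have hpos : ∀ r, 0 < r → 0 < S r := fun r hr => hS0 ▸ hS hr
  have hSc : Continuous S := continuous_iff_continuousAt.2 fun r => (hS' r).continuousAt
  refine ⟨hS, hSu, fun r => h.le_u _, fun r => h.le_q _, by rw [hS0, h.u_zero],
    by rw [hS0, h.q_zero], hS', fun r => (h.hasDerivAt_u _).comp r (hS' r), fun r => ?_, ?_, ?_,
    fun r => ?_, fun r hr => h.lt_u (hpos r hr), fun r hr => h.lt_q (hpos r hr)⟩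
  · refine ((h.hasDerivAt_q _).comp r (hS' r)).congr_deriv ?_
    rw [div_mul_div_comm, mul_one]
  · refine (h.continuous_u'.comp hSc).mul (continuous_const.div ?_ fun r =>
      (h.stretch_pos hα _).ne')
    exact (h.continuous_q.comp hSc).sub (continuous_const.mul (h.continuous_u.comp hSc))
  · rw [hS0, h.u'_zero, zero_mul]
  · rw [← h.mul_u' (S r)]
    calc r * (u' (S r) * (1 / (q (S r) - 2 * u (S r))))
        = S r * u (S r) * (u' (S r) * (1 / (q (S r) - 2 * u (S r)))) := by rw [hSu r]
      _ = _ := by ring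

/-! ### The ball obtained by cutting off a profile. -/

/-- Density of the ball with Eulerian profile functions `U`, `V`. -/
noncomputable def profileDensity (K : ℝ) (U V : ℝ → ℝ) (r : ℝ) : ℝ :=
  K / (U r ^ 2 * (V r - 2 * U r))

/-- Radial pressure of the ball with Eulerian profile functions `U`, `V`. -/
noncomputable def profileRad (lam mu : ℝ) (U V : ℝ → ℝ) (r : ℝ) : ℝ :=
  2 * mu + ((3 * lam + 4 * mu) - (lam + 2 * mu) * V r) / U r ^ 2

/-- Tangential pressure of the ball with Eulerian profile functions `U`, `V`. -/
noncomputable def profileTan (lam mu : ℝ) (U V : ℝ → ℝ) (r : ℝ) : ℝ :=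
  2 * mu - (lam + 2 * mu) / U r
    + ((3 * lam + 4 * mu) - 2 * (lam + 2 * mu) * U r) / (U r * (V r - 2 * U r))

/-- The function equal to `f` up to radius `R` and zero beyond. -/
noncomputable def cutoff (R : ℝ) (f : ℝ → ℝ) (r : ℝ) : ℝ := if r ≤ R then f r else 0

lemma cutoff_of_le {R r : ℝ} (f : ℝ → ℝ) (h : r ≤ R) : cutoff R f r = f r := if_pos h

lemma cutoff_of_lt {R r : ℝ} (f : ℝ → ℝ) (h : R < r) : cutoff R f r = 0 := if_neg (not_le.2 h)

/-- Smoothness is claimed only within the closed interval: a cut-off profile may jump at `R`, as the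
density does. -/
lemma contDiffOn_cutoff {R : ℝ} {f : ℝ → ℝ} (hf : ContDiff ℝ 1 f) :
    ContDiffOn ℝ 1 (cutoff R f) (Set.Icc 0 R) :=
  hf.contDiffOn.congr fun _ hr => cutoff_of_le f hr.2

lemma cutoff_eventuallyEq {R r : ℝ} (f : ℝ → ℝ) (h : r < R) : cutoff R f =ᶠ[𝓝 r] f := by
  filter_upwards [gt_mem_nhds h] with t ht using cutoff_of_le f ht.le

lemma tendsto_deriv_cutoff {R : ℝ} {f : ℝ → ℝ} (hR : 0 < R) (hf : ContDiff ℝ 1 f)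
    (h0 : HasDerivAt f 0 0) :
    Filter.Tendsto (deriv (cutoff R f)) (𝓝[>] 0) (𝓝 0) := by
  have h1 : Filter.Tendsto (deriv f) (𝓝 0) (𝓝 0) := by
    simpa [h0.deriv] using (hf.continuous_deriv le_rfl).tendsto 0
  refine (h1.congr' ?_).mono_left nhdsWithin_le_nhds
  filter_upwards [gt_mem_nhds hR] with r hr
  exact (cutoff_eventuallyEq f hr).deriv_eq.symm

/-- With stretches `U`, `U` and `W = V - 2U`, the normalized density is the inverse Jacobian `1/(U²
W)` and `η^(1/3) = 1/U`. -/
lemma rad_eq_johnRad (lam mu : ℝ) {U V ρ m : ℝ} (hU : 0 < U)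
    (hW : 0 < V - 2 * U) (hρ : ρ = 1 / (U ^ 2 * (V - 2 * U))) (hm : m = (1 / U) ^ 3) :
    2 * mu + ((3 * lam + 4 * mu) - (lam + 2 * mu) * V) / U ^ 2 = johnRad lam mu ρ m := by
  have h1 : 0 < 1 / U := by positivity
  rw [johnRad_eq lam mu (by rw [hρ]; positivity) (by rw [hm]; positivity), hm,
    pow_rpow_third h1, hρ]
  field_simp
  ring

lemma tan_eq_johnTan (lam mu : ℝ) {U V ρ m : ℝ} (hU : 0 < U)
    (hW : 0 < V - 2 * U) (hρ : ρ = 1 / (U ^ 2 * (V - 2 * U))) (hm : m = (1 / U) ^ 3) :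
    2 * mu - (lam + 2 * mu) / U
      + ((3 * lam + 4 * mu) - 2 * (lam + 2 * mu) * U) / (U * (V - 2 * U))
      = johnTan lam mu ρ m := by
  have h1 : 0 < 1 / U := by positivity
  rw [johnTan_eq lam mu (by rw [hρ]; positivity) (by rw [hm]; positivity), hm,
    pow_rpow_third h1, hρ]
  field_simp
  ring

namespace IsEulerianProfile

variable {C α : ℝ} {S U U' V : ℝ → ℝ}

lemma U_pos (h : IsEulerianProfile C α S U U' V) (hα : 0 < α) (r : ℝ) : 0 < U r :=
  hα.trans_le (h.le_U r)

lemma stretch_pos (h : IsEulerianProfile C α S U U' V) (hα : 0 < α) (r : ℝ) :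
    0 < V r - 2 * U r := by
  have := h.le_V r
  have := h.U_pos hα r
  linarith

lemma S_zero (h : IsEulerianProfile C α S U U' V) (hα : 0 < α) : S 0 = 0 := by
  rcases mul_eq_zero.1 (h.S_mul_U 0) with h0 | h0
  · exact h0
  · exact absurd h0 (h.U_pos hα _).ne'

lemma S_pos (h : IsEulerianProfile C α S U U' V) (hα : 0 < α) {r : ℝ} (hr : 0 < r) :
    0 < S r := h.S_zero hα ▸ h.strictMono_S hr

lemma contDiff_U (h : IsEulerianProfile C α S U U' V) : ContDiff ℝ 1 U :=
  contDiff_one_of_hasDerivAt h.hasDerivAt_U h.continuous_U'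

lemma continuous_S (h : IsEulerianProfile C α S U U' V) : Continuous S :=
  continuous_iff_continuousAt.2 fun s => (h.hasDerivAt_S s).continuousAt

lemma contDiff_V (h : IsEulerianProfile C α S U U' V) (hα : 0 < α) : ContDiff ℝ 1 V := by
  have hV : Continuous V := continuous_iff_continuousAt.2 fun s => (h.hasDerivAt_V s).continuousAt
  have hU := h.contDiff_U.continuous
  have hS := h.continuous_S
  refine contDiff_one_of_hasDerivAt h.hasDerivAt_V
    (Continuous.div (by fun_prop) (by fun_prop) fun r => ?_)
  have := h.U_pos hα r
  have := h.stretch_pos hα r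
  positivity

lemma contDiff_density (h : IsEulerianProfile C α S U U' V) (hα : 0 < α) (K : ℝ) :
    ContDiff ℝ 1 (profileDensity K U V) := by
  have := h.contDiff_U
  have := h.contDiff_V hα
  refine ContDiff.div contDiff_const (by fun_prop) fun r => ?_
  have := h.U_pos hα r
  have := h.stretch_pos hα r
  positivity

lemma contDiff_rad (h : IsEulerianProfile C α S U U' V) (hα : 0 < α) (lam mu : ℝ) :
    ContDiff ℝ 1 (profileRad lam mu U V) := by
  have := h.contDiff_U
  have := h.contDiff_V hα
  refine contDiff_const.add (ContDiff.div (by fun_prop) (by fun_prop) fun r => ?_)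
  have := h.U_pos hα r
  positivity

lemma contDiff_tan (h : IsEulerianProfile C α S U U' V) (hα : 0 < α) (lam mu : ℝ) :
    ContDiff ℝ 1 (profileTan lam mu U V) := by
  have := h.contDiff_U
  have := h.contDiff_V hα
  refine (contDiff_const.sub (ContDiff.div (by fun_prop) (by fun_prop) fun r => ?_)).add
    (ContDiff.div (by fun_prop) (by fun_prop) fun r => ?_)
  · exact (h.U_pos hα r).ne'
  · have := h.U_pos hα r
    have := h.stretch_pos hα r
    positivity

lemma hasDerivAt_U_zero (h : IsEulerianProfile C α S U U' V) : HasDerivAt U 0 0 :=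
  (h.hasDerivAt_U 0).congr_deriv h.U'_zero

lemma hasDerivAt_V_zero (h : IsEulerianProfile C α S U U' V) (hα : 0 < α) :
    HasDerivAt V 0 0 :=
  (h.hasDerivAt_V 0).congr_deriv (by rw [h.S_zero hα, mul_zero, zero_div])

lemma hasDerivAt_density_zero (h : IsEulerianProfile C α S U U' V) (hα : 0 < α) (K : ℝ) :
    HasDerivAt (profileDensity K U V) 0 0 := by
  have hU := h.hasDerivAt_U_zero
  have := h.U_pos hα 0
  have := h.stretch_pos hα 0
  refine ((hasDerivAt_const (0 : ℝ) K).div ((hU.pow 2).mul ((h.hasDerivAt_V_zero hα).sub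
    (hU.const_mul 2))) ?_).congr_deriv (by simp)
  simp only [Pi.mul_apply, Pi.pow_apply, Pi.sub_apply]
  positivity

lemma hasDerivAt_rad_zero (h : IsEulerianProfile C α S U U' V) (hα : 0 < α) (lam mu : ℝ) :
    HasDerivAt (profileRad lam mu U V) 0 0 := by
  have hU := h.hasDerivAt_U_zero
  have := h.U_pos hα 0
  refine (((((h.hasDerivAt_V_zero hα).const_mul (lam + 2 * mu)).const_sub
    (3 * lam + 4 * mu)).div (hU.pow 2) ?_).const_add (2 * mu)).congr_deriv (by simp)
  simp only [Pi.pow_apply]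
  positivity

lemma hasDerivAt_tan_zero (h : IsEulerianProfile C α S U U' V) (hα : 0 < α) (lam mu : ℝ) :
    HasDerivAt (profileTan lam mu U V) 0 0 := by
  have hU := h.hasDerivAt_U_zero
  have h1 := h.U_pos hα 0
  have := h.stretch_pos hα 0
  refine ((((hasDerivAt_const (0 : ℝ) (lam + 2 * mu)).div hU h1.ne').const_sub (2 * mu)).add
    (((hU.const_mul (2 * (lam + 2 * mu))).const_sub (3 * lam + 4 * mu)).div
      (hU.mul ((h.hasDerivAt_V_zero hα).sub (hU.const_mul 2))) ?_)).congr_deriv (by simp)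
  simp only [Pi.mul_apply, Pi.sub_apply]
  positivity

lemma density_pos (h : IsEulerianProfile C α S U U' V) (hα : 0 < α) {K : ℝ} (hK : 0 < K)
    (r : ℝ) : 0 < profileDensity K U V r := by
  have := h.U_pos hα r
  have := h.stretch_pos hα r
  unfold profileDensity
  positivity

/-- Conservation of mass: the matter inside `r` fills, in the reference state, a ball of radius `S
r` and constant density `K`. -/
lemma mass_eq (h : IsEulerianProfile C α S U U' V) (hα : 0 < α) (K : ℝ) {R r : ℝ} (hr : r ≤ R)
    (hr0 : 0 ≤ r) :
    mass (cutoff R (profileDensity K U V)) r = 4 * Real.pi / 3 * K * S r ^ 3 := by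
  have hd : ∀ t ∈ Set.uIcc 0 r, HasDerivAt (fun t => K / 3 * S t ^ 3)
      (profileDensity K U V t * t ^ 2) t := by
    intro t _
    refine (((h.hasDerivAt_S t).pow 3).const_mul (K / 3)).congr_deriv ?_
    have h1 := h.U_pos hα t
    have h2 := h.stretch_pos hα t
    have h4 : t ^ 2 = (S t * U t) ^ 2 := by rw [h.S_mul_U t]
    rw [profileDensity, h4]
    norm_num
    field_simp
  have hc : Continuous fun t => profileDensity K U V t * t ^ 2 :=
    (h.contDiff_density hα K).continuous.mul (by fun_prop)
  unfold mass
  rw [intervalIntegral.integral_congr (g := fun t => profileDensity K U V t * t ^ 2),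
    intervalIntegral.integral_eq_sub_of_hasDerivAt hd (hc.intervalIntegrable _ _), h.S_zero hα]
  · ring
  · intro t ht
    rw [Set.uIcc_of_le hr0] at ht
    simp only [cutoff_of_le _ (ht.2.trans hr)]

lemma meanDensity_eq (h : IsEulerianProfile C α S U U' V) (hα : 0 < α) {K : ℝ} (hK : 0 < K)
    {R r : ℝ} (hr : r ≤ R) (hr0 : 0 < r) :
    meanDensity K (cutoff R (profileDensity K U V)) r = (1 / U r) ^ 3 := by
  have h1 := h.U_pos hα r
  have h2 := h.S_pos hα hr0
  have h3 := Real.pi_pos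
  have h4 : r ^ 3 = (S r * U r) ^ 3 := by rw [h.S_mul_U r]
  rw [meanDensity, h.mass_eq hα K hr hr0.le, h4]
  field_simp

lemma normDensity_eq {K : ℝ} (hK : 0 < K) {R r : ℝ} (hr : r ≤ R) :
    normDensity K (cutoff R (profileDensity K U V)) r = 1 / (U r ^ 2 * (V r - 2 * U r)) := by
  rw [normDensity, cutoff_of_le _ hr, profileDensity, div_div, mul_comm, ← div_div,
    div_self hK.ne']

/-- Put `a = λ + 2μ`, `b = 3λ + 4μ`, `W = V - 2U`. The pressure difference factors as `(W - U)(b -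
aV)/(U² W)`, so the `U'` term of the derivative is exactly the anisotropy term. What remains, `-a
V'/U²`, is gravity by the choice of `C`. -/
lemma hasDerivAt_rad (h : IsEulerianProfile C α S U U' V) (hα : 0 < α) {lam mu K : ℝ}
    (ha : 0 < lam + 2 * mu) (hC : C = 4 * Real.pi * K ^ 2 / (3 * (lam + 2 * mu)))
    {r : ℝ} (hr : 0 < r) :
    HasDerivAt (profileRad lam mu U V)
      (-(2 / r) * (profileRad lam mu U V r - profileTan lam mu U V r)
        - profileDensity K U V r * (4 * Real.pi / 3 * K * S r / U r ^ 2)) r := by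
  have h1 := h.U_pos hα r
  have h2 := h.stretch_pos hα r
  have h3 := h.S_pos hα hr
  have hU' : U' r = (V r - 3 * U r) * U r / (r * (V r - 2 * U r)) := by
    have := h.mul_U' r
    field_simp at this ⊢
    linarith
  refine (((((h.hasDerivAt_V r).const_mul (lam + 2 * mu)).const_sub
    (3 * lam + 4 * mu)).div ((h.hasDerivAt_U r).pow 2) (pow_ne_zero 2 h1.ne')).const_add
      (2 * mu)).congr_deriv ?_
  rw [hU', hC]
  unfold profileRad profileTan profileDensity
  simp only [Pi.pow_apply]
  have h4 := (h.S_mul_U r).symm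
  generalize S r = s at *
  generalize U r = x at *
  -- The radial stretch becomes the variable, so that the denominators are monomials.
  obtain ⟨w, hw⟩ : ∃ w, V r = w + 2 * x := ⟨V r - 2 * x, by ring⟩
  rw [hw] at h2 ⊢
  rw [add_sub_cancel_right] at h2 ⊢
  subst h4
  norm_num
  field_simp
  ring

/-- After multiplication by `U (V - 2U)`, the tangential pressure is the radial numerator plus `2μ U
(V - 3U)`, which is nonnegative. -/
lemma tan_pos (h : IsEulerianProfile C α S U U' V) (hα : 0 < α) {lam mu : ℝ} (hmu : 0 ≤ mu)
    {r : ℝ} (hG : 0 < 2 * mu * U r ^ 2 + (3 * lam + 4 * mu) - (lam + 2 * mu) * V r) :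
    0 < profileTan lam mu U V r := by
  have h1 := h.U_pos hα r
  have h2 := h.stretch_pos hα r
  have h3 := h.le_V r
  have e : profileTan lam mu U V r = ((2 * mu * U r ^ 2 + (3 * lam + 4 * mu)
      - (lam + 2 * mu) * V r) + 2 * mu * U r * (V r - 3 * U r)) / (U r * (V r - 2 * U r)) := by
    unfold profileTan
    field_simp
    ring
  rw [e]
  have : 0 ≤ 2 * mu * U r * (V r - 3 * U r) := by
    have : 0 ≤ V r - 3 * U r := by linarith
    positivity
  positivity

lemma rad_eq (h : IsEulerianProfile C α S U U' V) (hα : 0 < α) (lam mu r : ℝ) :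
    profileRad lam mu U V r
      = (2 * mu * U r ^ 2 + (3 * lam + 4 * mu) - (lam + 2 * mu) * V r) / U r ^ 2 := by
  have h1 := h.U_pos hα r
  unfold profileRad
  field_simp
  ring

/-- Cutting off an Eulerian profile where its radial pressure vanishes yields a ball. -/
theorem isStronglyRegularBall (h : IsEulerianProfile C α S U U' V) (hα : 0 < α) {lam mu K R : ℝ}
    (hmu : 0 ≤ mu) (ha : 0 < lam + 2 * mu) (hK : 0 < K)
    (hC : C = 4 * Real.pi * K ^ 2 / (3 * (lam + 2 * mu))) (hR : 0 < R)
    (hG : ∀ r ∈ Set.Ico 0 R,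
      0 < 2 * mu * U r ^ 2 + (3 * lam + 4 * mu) - (lam + 2 * mu) * V r)
    (hGR : 2 * mu * U R ^ 2 + (3 * lam + 4 * mu) - (lam + 2 * mu) * V R = 0) :
    IsStronglyRegularBall R (cutoff R (profileDensity K U V)) (cutoff R (profileRad lam mu U V))
      (cutoff R (profileTan lam mu U V)) := by
  have hsub : Set.Ioc 0 R ⊆ Set.Icc 0 R := Set.Ioc_subset_Icc_self
  have hρ := contDiffOn_cutoff (R := R) (h.contDiff_density hα K)
  have hp := contDiffOn_cutoff (R := R) (h.contDiff_rad hα lam mu)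
  have ht := contDiffOn_cutoff (R := R) (h.contDiff_tan hα lam mu)
  refine
    { radius_pos := hR
      support := ?_
      continuousOn_density := hρ.continuousOn
      continuousOn_prad := hp.continuousOn
      continuousOn_ptan := ht.continuousOn
      contDiffOn_density := hρ.mono hsub
      contDiffOn_prad := hp.mono hsub
      contDiffOn_ptan := ht.mono hsub
      equilibrium := ?_
      prad_pos := fun r hr => ?_
      ptan_pos := fun r hr => ?_
      prad_boundary := ?_
      center := ?_
      vacuum := fun r hr => ⟨cutoff_of_lt _ hr, cutoff_of_lt _ hr, cutoff_of_lt _ hr⟩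
      contDiffOn_density' := hρ
      contDiffOn_prad' := hp
      contDiffOn_ptan' := ht
      tendsto_deriv_density :=
        tendsto_deriv_cutoff hR (h.contDiff_density hα K) (h.hasDerivAt_density_zero hα K)
      tendsto_deriv_prad :=
        tendsto_deriv_cutoff hR (h.contDiff_rad hα lam mu) (h.hasDerivAt_rad_zero hα lam mu)
      tendsto_deriv_ptan :=
        tendsto_deriv_cutoff hR (h.contDiff_tan hα lam mu) (h.hasDerivAt_tan_zero hα lam mu) }
  · have : {r : ℝ | 0 < r ∧ 0 < cutoff R (profileDensity K U V) r} = Set.Ioc 0 R := by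
      ext r
      simp only [Set.mem_ofPred_eq, Set.mem_Ioc, and_congr_right_iff]
      intro _
      refine ⟨fun hr => ?_, fun hr => ?_⟩
      · by_contra! hc
        rw [cutoff_of_lt _ hc] at hr
        exact lt_irrefl _ hr
      · rw [cutoff_of_le _ hr]
        exact h.density_pos hα hK r
    rw [this, interior_Ioc]
  · have hc : Continuous fun t => 4 * Real.pi / 3 * K * S t / U t ^ 2 := by
      have hS := h.continuous_S
      have hU := h.contDiff_U.continuous
      exact Continuous.div (by fun_prop) (by fun_prop) fun t => pow_ne_zero 2 (h.U_pos hα t).ne'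
    -- Since `m = (4π/3) K S³` and `r = S U`, the field `m/r²` equals this integrand, which is
    -- continuous through the center.
    refine ⟨fun r => ∫ t in (0 : ℝ)..r, 4 * Real.pi / 3 * K * S t / U t ^ 2, fun r hr => ?_⟩
    have hΦ := (hc.integral_hasStrictDerivAt 0 r).hasDerivAt
    rw [hΦ.deriv, cutoff_of_le _ hr.2.le, cutoff_of_le _ hr.2.le, cutoff_of_le _ hr.2.le,
      h.mass_eq hα K hr.2.le hr.1.le]
    refine ⟨hΦ.congr_deriv ?_, (h.hasDerivAt_rad hα ha hC hr.1).congr_of_eventuallyEq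
      (cutoff_eventuallyEq _ hr.2)⟩
    have h1 := h.U_pos hα r
    have h2 := h.S_pos hα hr.1
    have h4 : r ^ 2 = (S r * U r) ^ 2 := by rw [h.S_mul_U r]
    rw [h4]
    field_simp
  · rw [cutoff_of_le _ hr.2.le, h.rad_eq hα]
    exact div_pos (hG r hr) (pow_pos (h.U_pos hα r) 2)
  · rw [cutoff_of_le _ hr.2.le]
    exact h.tan_pos hα hmu (hG r hr)
  · rw [cutoff_of_le _ le_rfl, h.rad_eq hα, hGR, zero_div]
  · rw [cutoff_of_le _ hR.le, cutoff_of_le _ hR.le, profileRad, profileTan, h.U_zero, h.V_zero]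
    have : 3 * α - 2 * α = α := by ring
    rw [this]
    field_simp
    ring

theorem isElastic (h : IsEulerianProfile C α S U U' V) (hα : 0 < α) (lam mu : ℝ) {K R : ℝ}
    (hK : 0 < K) :
    IsElastic K (johnRad lam mu) (johnTan lam mu) (cutoff R (profileDensity K U V))
      (cutoff R (profileRad lam mu U V)) (cutoff R (profileTan lam mu U V)) := by
  have hle : ∀ r, 0 < cutoff R (profileDensity K U V) r → r ≤ R := by
    intro r hr
    by_contra! hc
    rw [cutoff_of_lt _ hc] at hr
    exact lt_irrefl _ hr
  refine ⟨contDiffOn_johnRad lam mu, contDiffOn_johnTan lam mu, fun r hr hp => ?_,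
    fun r hr hp => ?_⟩
  · rw [cutoff_of_le _ (hle r hp)]
    exact rad_eq_johnRad lam mu (h.U_pos hα r) (h.stretch_pos hα r)
      (normDensity_eq hK (hle r hp)) (h.meanDensity_eq hα hK (hle r hp) hr)
  · rw [cutoff_of_le _ (hle r hp)]
    exact tan_eq_johnTan lam mu (h.U_pos hα r) (h.stretch_pos hα r)
      (normDensity_eq hK (hle r hp)) (h.meanDensity_eq hα hK (hle r hp) hr)

end IsEulerianProfile

/-! ### Uniqueness of the profile. -/

/-- Any solution of the equilibrium equations in Eulerian form with the same central data agrees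
with the Lagrangian profile. -/
theorem IsLagrangianProfile.eq_of_eulerian {C α : ℝ} {u u' q : ℝ → ℝ}
    (h : IsLagrangianProfile C α u u' q) (hC : 0 < C) (hα : 0 < α) {R c : ℝ} (hc : 0 < c)
    {s v Q : ℝ → ℝ} (hs : ∀ r ∈ Set.Ioo 0 R, 0 < s r) (hsv : ∀ r ∈ Set.Ioo 0 R, s r * v r = r)
    (hv : ∀ r ∈ Set.Ioo 0 R, c ≤ v r) (hW : ∀ r ∈ Set.Ioo 0 R, 0 < Q r - 2 * v r)
    (hs' : ∀ r ∈ Set.Ioo 0 R, HasDerivAt s (1 / (Q r - 2 * v r)) r)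
    (hQ' : ∀ r ∈ Set.Ioo 0 R, HasDerivAt Q (C * s r / (v r ^ 2 * (Q r - 2 * v r))) r)
    (hs0 : Filter.Tendsto s (𝓝[>] 0) (𝓝 0)) (hQ0 : Filter.Tendsto Q (𝓝[>] 0) (𝓝 (3 * α))) :
    ∀ r ∈ Set.Ioo 0 R, s r * u (s r) = r ∧ Q r = q (s r) := by
  -- A common lower bound for `v` and `u`, on which `1/y²` is Lipschitz with constant `2/β³`.
  set β := min c α with hβ
  have hβ0 : 0 < β := lt_min hc hα
  set κ := 1 + C * (2 / β ^ 3) with hκ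
  -- `D` and `E` measure how far the solution is from the profile at the same reference radius. The
  -- weight `exp (-κ s)` makes this a Gronwall argument in `s`: since `s' = 1/W` with `W = Q - 2v`,
  -- all terms of the derivative carry the same factor `1/W`.
  set D : ℝ → ℝ := fun r => r - s r * u (s r) with hD
  set E : ℝ → ℝ := fun r => Q r - q (s r) with hE
  set M : ℝ → ℝ := fun r => (D r ^ 2 + E r ^ 2) * Real.exp (-(κ * s r)) with hM
  have hD' : ∀ r ∈ Set.Ioo 0 R, HasDerivAt D
      (1 - (q (s r) - 2 * u (s r)) * (1 / (Q r - 2 * v r))) r := fun r hr =>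
    (hasDerivAt_id r).sub ((h.hasDerivAt_radius (s r)).comp r (hs' r hr))
  have hE' : ∀ r ∈ Set.Ioo 0 R, HasDerivAt E (C * s r / (v r ^ 2 * (Q r - 2 * v r))
      - C * s r / u (s r) ^ 2 * (1 / (Q r - 2 * v r))) r := fun r hr =>
    (hQ' r hr).sub ((h.hasDerivAt_q (s r)).comp r (hs' r hr))
  have hM' : ∀ r ∈ Set.Ioo 0 R, ∃ m ≤ 0, HasDerivAt M m r := by
    intro r hr
    refine ⟨_, ?_, (((hD' r hr).pow 2).add ((hE' r hr).pow 2)).mul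
      ((((hs' r hr).const_mul κ).neg).exp)⟩
    simp only [Pi.add_apply, Pi.pow_apply]
    have hu0 := h.u_pos hα (s r)
    have hv0 := hc.trans_le (hv r hr)
    have hW0 := hW r hr
    have hsr := hs r hr
    have hDr : s r * (v r - u (s r)) = D r := by
      rw [mul_sub, hsv r hr]
    have hlip := abs_inv_sq_sub_inv_sq_le hβ0 ((min_le_left c α).trans (hv r hr))
      ((min_le_right c α).trans (h.le_u (s r)))
    -- The factor `s` in the source compensates for `v - u = D/s`, so no singular term arises here.
    have h1 : |s r * (1 / v r ^ 2 - 1 / u (s r) ^ 2)| ≤ 2 / β ^ 3 * |D r| := by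
      rw [abs_mul, ← hDr, abs_mul, abs_of_pos hsr]
      calc _ ≤ s r * (2 / β ^ 3 * |v r - u (s r)|) := by gcongr
        _ = _ := by ring
    set e := s r * (1 / v r ^ 2 - 1 / u (s r) ^ 2) with he
    have h2 : E r * e ≤ 2 / β ^ 3 * (|E r| * |D r|) := by
      calc E r * e ≤ |E r * e| := le_abs_self _
        _ = |E r| * |e| := abs_mul _ _
        _ ≤ |E r| * (2 / β ^ 3 * |D r|) := by gcongr
        _ = _ := by ring
    have h3 : |E r| * |D r| ≤ (D r ^ 2 + E r ^ 2) / 2 := by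
      rw [← sq_abs (D r), ← sq_abs (E r)]
      nlinarith [sq_nonneg (|E r| - |D r|)]
    have h4 : E r * e ≤ 2 / β ^ 3 * ((D r ^ 2 + E r ^ 2) / 2) :=
      h2.trans (mul_le_mul_of_nonneg_left h3 (by positivity))
    -- The term of `D'` that is singular at the center contributes `-2 D (v - u) = -2 s (v - u)²`,
    -- of favorable sign, and is dropped.
    have h5 : 0 ≤ D r * (v r - u (s r)) := by
      rw [← hDr, mul_assoc]
      exact mul_nonneg hsr.le (mul_self_nonneg _)
    have hEr : E r = Q r - q (s r) := rfl
    have key : D r * (E r - 2 * (v r - u (s r))) + C * (E r * e)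
        ≤ κ * (D r ^ 2 + E r ^ 2) / 2 := by
      have := mul_le_mul_of_nonneg_left h4 hC.le
      have h6 : D r * E r ≤ (D r ^ 2 + E r ^ 2) / 2 := by nlinarith [sq_nonneg (D r - E r)]
      rw [hκ]
      linarith
    have e1 : (1 - (q (s r) - 2 * u (s r)) * (1 / (Q r - 2 * v r)))
        = (E r - 2 * (v r - u (s r))) / (Q r - 2 * v r) := by
      rw [hEr]; field_simp; ring
    have e2 : C * s r / (v r ^ 2 * (Q r - 2 * v r))
        - C * s r / u (s r) ^ 2 * (1 / (Q r - 2 * v r)) = C * e / (Q r - 2 * v r) := by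
      rw [he]; field_simp
    rw [e1, e2]
    norm_num
    set X := Real.exp (-(κ * s r))
    have hX : 0 < X := Real.exp_pos _
    have hform : (2 * D r * ((E r - 2 * (v r - u (s r))) / (Q r - 2 * v r))
        + 2 * E r * (C * e / (Q r - 2 * v r))) * X
        - (D r ^ 2 + E r ^ 2) * (X * (κ * (Q r - 2 * v r)⁻¹))
        = 2 * (X * (Q r - 2 * v r)⁻¹) * (D r * (E r - 2 * (v r - u (s r))) + C * (E r * e)
          - κ * (D r ^ 2 + E r ^ 2) / 2) := by
      field_simp
    have : (2 * (X * (Q r - 2 * v r)⁻¹)) * (D r * (E r - 2 * (v r - u (s r))) + C * (E r * e)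
          - κ * (D r ^ 2 + E r ^ 2) / 2) ≤ 0 :=
      mul_nonpos_of_nonneg_of_nonpos (by positivity) (by linarith)
    linarith
  have hanti : AntitoneOn M (Set.Ioo 0 R) := by
    apply antitoneOn_of_deriv_nonpos (convex_Ioo 0 R)
    · intro r hr
      obtain ⟨m, -, hm⟩ := hM' r hr
      exact hm.continuousAt.continuousWithinAt
    · intro r hr
      rw [interior_Ioo] at hr
      obtain ⟨m, -, hm⟩ := hM' r hr
      exact hm.differentiableAt.differentiableWithinAt
    · intro r hr
      rw [interior_Ioo] at hr
      obtain ⟨m, hm0, hm⟩ := hM' r hr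
      rwa [hm.deriv]
  have hM0 : Filter.Tendsto M (𝓝[>] 0) (𝓝 0) := by
    have hid : Filter.Tendsto (fun r : ℝ => r) (𝓝[>] 0) (𝓝 0) := nhdsWithin_le_nhds
    have hus := (h.continuous_u.tendsto 0).comp hs0
    have hqs := (h.continuous_q.tendsto 0).comp hs0
    have hexp := (Real.continuous_exp.tendsto _).comp (hs0.const_mul κ).neg
    have := (((hid.sub (hs0.mul hus)).pow 2).add ((hQ0.sub hqs).pow 2)).mul hexp
    simpa [h.q_zero] using this
  intro r hr
  -- `M` is antitone and tends to `0` at the center, while it is a sum of squares times a positive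
  -- weight.
  have hMr : M r ≤ 0 := by
    refine ge_of_tendsto hM0 ?_
    filter_upwards [Ioo_mem_nhdsGT hr.1] with t ht
    exact hanti ⟨ht.1, ht.2.trans hr.2⟩ hr ht.2.le
  have hN : D r ^ 2 + E r ^ 2 ≤ 0 := by
    by_contra! hc
    exact absurd (mul_pos hc (Real.exp_pos (-(κ * s r)))) (not_lt.2 hMr)
  have hDz : D r = 0 := by nlinarith [sq_nonneg (D r), sq_nonneg (E r)]
  have hEz : E r = 0 := by nlinarith [sq_nonneg (D r), sq_nonneg (E r)]
  exact ⟨(sub_eq_zero.1 hDz).symm, sub_eq_zero.1 hEz⟩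

/-! ### Every regular ball follows the profile. -/

namespace IsRegularBall

variable {R : ℝ} {ρ prad ptan : ℝ → ℝ}

lemma density_pos (h : IsRegularBall R ρ prad ptan) {r : ℝ} (hr : r ∈ Set.Ioo 0 R) : 0 < ρ r := by
  rw [← h.support] at hr
  exact (interior_subset hr).2

/-- The mean density of a regular ball extends continuously to the center and obeys the
continuity equation. -/
lemma exists_meanDensity (h : IsRegularBall R ρ prad ptan) {K : ℝ} (hK : 0 < K) :
    ∃ H : ℝ → ℝ, Continuous H ∧ H 0 = ρ 0 / K ∧ ∀ r ∈ Set.Ioo 0 R,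
      0 < H r ∧ meanDensity K ρ r = H r ∧ mass ρ r = 4 * Real.pi / 3 * K * r ^ 3 * H r ∧
      HasDerivAt H (3 / r * (ρ r / K - H r)) r := by
  have hR := h.radius_pos
  -- The density is controlled only on `[0, R]`; a continuous extension allows integral calculus on
  -- the whole line.
  set ρe : ℝ → ℝ := Set.IccExtend hR.le (Set.domRestrict (Set.Icc 0 R) ρ) with hρe
  have hρec : Continuous ρe := h.continuousOn_density.domRestrict.Icc_extend'
  have hρeq : ∀ r ∈ Set.Icc 0 R, ρe r = ρ r := fun r hr => by
    rw [hρe, Set.IccExtend_of_mem _ _ hr]; rfl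
  set J : ℝ → ℝ := fun r => ∫ σ in (0 : ℝ)..1, σ ^ 2 * ρe (r * σ) with hJ
  set M : ℝ → ℝ := fun r => ∫ t in (0 : ℝ)..r, t ^ 2 * ρe t with hM
  have hJM : ∀ r, r ^ 3 * J r = M r := fun r => pow_mul_integral_comp_mul 2 ρe r
  have hM' : ∀ r, HasDerivAt M (r ^ 2 * ρe r) r := fun r =>
    ((Continuous.mul (by fun_prop) hρec : Continuous fun t => t ^ 2 * ρe t).integral_hasStrictDerivAt
      0 r).hasDerivAt
  have hmass : ∀ r ∈ Set.Ioo 0 R, mass ρ r = 4 * Real.pi * M r := by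
    intro r hr
    unfold mass
    congr 1
    apply intervalIntegral.integral_congr
    intro t ht
    rw [Set.uIcc_of_le hr.1.le] at ht
    simp only [hρeq t ⟨ht.1, ht.2.trans hr.2.le⟩]
    ring
  have hπ := Real.pi_pos
  refine ⟨fun r => 3 / K * J r,
    continuous_const.mul (continuous_integral_comp_mul (by fun_prop) hρec), ?_, fun r hr => ?_⟩
  · simp only [hJ, zero_mul, hρeq 0 ⟨le_rfl, hR.le⟩, intervalIntegral.integral_mul_const,
      integral_pow]
    norm_num
    field_simp
  · have hr0 := hr.1
    refine ⟨?_, ?_, ?_, ?_⟩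
    · have : 0 < J r := by
        apply intervalIntegral.intervalIntegral_pos_of_pos_on
        · exact (Continuous.mul (by fun_prop) (hρec.comp (by fun_prop))).intervalIntegrable _ _
        · intro σ hσ
          have hm : r * σ ∈ Set.Ioo 0 R :=
            ⟨mul_pos hr0 hσ.1, (mul_lt_of_lt_one_right hr0 hσ.2).trans hr.2⟩
          rw [hρeq _ ⟨hm.1.le, hm.2.le⟩]
          exact mul_pos (pow_pos hσ.1 2) (h.density_pos hm)
        · exact one_pos
      positivity
    · rw [meanDensity, hmass r hr, ← hJM]
      field_simp
    · rw [hmass r hr, ← hJM]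
      field_simp
    · have hev : (fun r => 3 / K * J r) =ᶠ[𝓝 r] fun t => 3 / K * (M t / t ^ 3) := by
        filter_upwards [lt_mem_nhds hr0] with t ht
        rw [← hJM]
        field_simp
      refine ((((hM' r).div (hasDerivAt_pow 3 r) (pow_ne_zero 3 hr0.ne')).const_mul
        (3 / K)).congr_of_eventuallyEq hev).congr_deriv ?_
      rw [← hJM, hρeq r ⟨hr0.le, hr.2.le⟩]
      norm_num
      field_simp

/-- A regular ball of the John material is described, inside its support, by the Lagrangian
profile with the same central density. -/
theorem eq_profile (hB : IsRegularBall R ρ prad ptan) {lam mu K C α : ℝ}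
    (hE : IsElastic K (johnRad lam mu) (johnTan lam mu) ρ prad ptan)
    (ha : 0 < lam + 2 * mu) (hK : 0 < K) (hα : 0 < α)
    (hC : C = 4 * Real.pi * K ^ 2 / (3 * (lam + 2 * mu))) (hρ0 : ρ 0 = K / α ^ 3)
    {u u' q S : ℝ → ℝ} (h : IsLagrangianProfile C α u u' q) (hSu : ∀ s, S (s * u s) = s) :
    ∀ r ∈ Set.Ioo 0 R, ρ r = profileDensity K (fun r => u (S r)) (fun r => q (S r)) r ∧
      prad r = profileRad lam mu (fun r => u (S r)) (fun r => q (S r)) r ∧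
      ptan r = profileTan lam mu (fun r => u (S r)) (fun r => q (S r)) r := by
  have hπ := Real.pi_pos
  have hR := hB.radius_pos
  obtain ⟨H, hHc, hH0, hH⟩ := hB.exists_meanDensity hK
  obtain ⟨Φ, hΦ⟩ := hB.equilibrium
  set x : ℝ → ℝ := fun r => H r ^ (1 / 3 : ℝ) with hx
  have hxc : Continuous x := hHc.rpow_const fun _ => Or.inr (by norm_num)
  have hx0 : x 0 = 1 / α := by
    have : H 0 = (1 / α) ^ 3 := by rw [hH0, hρ0]; field_simp
    simp only [hx, this]
    exact pow_rpow_third (by positivity)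
  have hxp : ∀ r ∈ Set.Ioo 0 R, 0 < x r := fun r hr => Real.rpow_pos_of_pos (hH r hr).1 _
  have hx3 : ∀ r ∈ Set.Ioo 0 R, x r ^ 3 = H r := fun r hr => rpow_third_pow (hH r hr).1
  have hδp : ∀ r ∈ Set.Ioo 0 R, 0 < ρ r / K := fun r hr => div_pos (hB.density_pos hr) hK
  have hx' : ∀ r ∈ Set.Ioo 0 R, HasDerivAt x ((ρ r / K - x r ^ 3) / (r * x r ^ 2)) r := by
    intro r hr
    refine ((hasDerivAt_rpow_third (hH r hr).1).comp r (hH r hr).2.2.2).congr_deriv ?_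
    have h1 := hxp r hr
    have h2 := hr.1
    rw [hx3 r hr]
    change 1 / (3 * x r ^ 2) * _ = _
    field_simp
  have hprad : ∀ r ∈ Set.Ioo 0 R, prad r = 2 * mu - (lam + 2 * mu) * x r ^ 4 / (ρ r / K)
      - 2 * (lam + 2 * mu) * x r + (3 * lam + 4 * mu) * x r ^ 2 := by
    intro r hr
    rw [hE.prad_eq r hr.1 (hB.density_pos hr), (hH r hr).2.1]
    exact johnRad_eq lam mu (hδp r hr) (hH r hr).1
  have hptan : ∀ r ∈ Set.Ioo 0 R, ptan r = 2 * mu - (lam + 2 * mu) * x r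
      - 2 * (lam + 2 * mu) * (ρ r / K) / x r ^ 2
      + (3 * lam + 4 * mu) * (ρ r / K) / x r := by
    intro r hr
    rw [hE.ptan_eq r hr.1 (hB.density_pos hr), (hH r hr).2.1]
    exact johnTan_eq lam mu (hδp r hr) (hH r hr).1
  -- The trace is expressed through `prad` instead of `ρ`, so that its derivative comes from the
  -- equilibrium equation.
  set Q : ℝ → ℝ := fun r =>
    ((3 * lam + 4 * mu) + (2 * mu - prad r) * (x r)⁻¹ ^ 2) / (lam + 2 * mu) with hQ
  have hQeq : ∀ r ∈ Set.Ioo 0 R, Q r = x r ^ 2 / (ρ r / K) + 2 / x r := by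
    intro r hr
    have h1 := hxp r hr
    have h2 := hδp r hr
    simp only [hQ, hprad r hr]
    rw [div_eq_iff ha.ne']
    generalize ρ r / K = δ at *
    field_simp
    ring
  have hW : ∀ r ∈ Set.Ioo 0 R, Q r - 2 * (x r)⁻¹ = x r ^ 2 / (ρ r / K) := by
    intro r hr
    rw [hQeq r hr]
    ring
  have hQ' : ∀ r ∈ Set.Ioo 0 R, HasDerivAt Q
      (C * (r * x r) / ((x r)⁻¹ ^ 2 * (Q r - 2 * (x r)⁻¹))) r := by
    intro r hr
    have h1 := hxp r hr
    have h2 := hδp r hr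
    have h3 := hr.1
    refine (((((hΦ r hr).2.const_sub (2 * mu)).mul (((hx' r hr).inv h1.ne').pow 2)).const_add
      (3 * lam + 4 * mu)).div_const (lam + 2 * mu)).congr_deriv ?_
    rw [hW r hr, (hΦ r hr).1.deriv, (hH r hr).2.2.1, ← hx3 r hr, hprad r hr, hptan r hr, hC]
    have h4 : ρ r = K * (ρ r / K) := by field_simp
    simp only [Pi.pow_apply, Pi.inv_apply]
    generalize hδ : ρ r / K = δ at *
    rw [h4]
    norm_num
    field_simp
    ring
  have hs' : ∀ r ∈ Set.Ioo 0 R, HasDerivAt (fun r => r * x r) (1 / (Q r - 2 * (x r)⁻¹)) r := by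
    intro r hr
    have h1 := hxp r hr
    have h2 := hδp r hr
    have h3 := hr.1
    refine ((hasDerivAt_id r).mul (hx' r hr)).congr_deriv ?_
    rw [hW r hr]
    generalize ρ r / K = δ at *
    simp only [id]
    field_simp
    ring
  -- An upper bound on `x` keeps `v = 1/x` away from zero; the maximum with `1` makes the bound
  -- positive.
  obtain ⟨B, hBx⟩ := (isCompact_Icc (a := (0 : ℝ)) (b := R)).bddAbove_image hxc.continuousOn
  have hxB : ∀ r ∈ Set.Ioo 0 R, x r ≤ max B 1 := fun r hr =>
    (hBx ⟨r, ⟨hr.1.le, hr.2.le⟩, rfl⟩).trans (le_max_left _ _)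
  have hIoo : Set.Ioo 0 R ∈ 𝓝[>] (0 : ℝ) := Ioo_mem_nhdsGT hR
  have hxlim : Filter.Tendsto x (𝓝[>] 0) (𝓝 (1 / α)) :=
    hx0 ▸ (hxc.tendsto 0).mono_left nhdsWithin_le_nhds
  have hρlim : Filter.Tendsto ρ (𝓝[>] 0) (𝓝 (K / α ^ 3)) := by
    have := hB.continuousOn_density 0 ⟨le_rfl, hR.le⟩
    rw [ContinuousWithinAt, hρ0] at this
    rw [← nhdsWithin_Ioo_eq_nhdsGT hR]
    exact this.mono_left (nhdsWithin_mono _ Set.Ioo_subset_Icc_self)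
  have hs0 : Filter.Tendsto (fun r => r * x r) (𝓝[>] 0) (𝓝 0) := by
    have : Continuous fun r => r * x r := continuous_id.mul hxc
    simpa using (this.tendsto 0).mono_left (nhdsWithin_le_nhds (s := Set.Ioi 0))
  have hQ0 : Filter.Tendsto Q (𝓝[>] 0) (𝓝 (3 * α)) := by
    have h1 : Filter.Tendsto (fun r => x r ^ 2 / (ρ r / K) + 2 / x r) (𝓝[>] 0)
        (𝓝 ((1 / α) ^ 2 / (K / α ^ 3 / K) + 2 / (1 / α))) :=
      ((hxlim.pow 2).div (hρlim.div_const K) (by positivity)).add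
        (tendsto_const_nhds.div hxlim (by positivity))
    have h2 : (1 / α) ^ 2 / (K / α ^ 3 / K) + 2 / (1 / α) = 3 * α := by
      field_simp; ring
    rw [h2] at h1
    refine h1.congr' ?_
    filter_upwards [hIoo] with r hr using (hQeq r hr).symm
  have hmain := h.eq_of_eulerian (hC ▸ by positivity) hα (R := R) (c := (max B 1)⁻¹)
    (s := fun r => r * x r) (v := fun r => (x r)⁻¹) (Q := Q)
    (inv_pos.2 (lt_of_lt_of_le one_pos (le_max_right _ _)))
    (fun r hr => mul_pos hr.1 (hxp r hr))
    (fun r hr => by have := hxp r hr; field_simp)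
    (fun r hr => inv_anti₀ (hxp r hr) (hxB r hr))
    (fun r hr => by
      have h1 := hxp r hr
      have h2 := hδp r hr
      rw [hW r hr]; positivity)
    hs' hQ' hs0 hQ0
  intro r hr
  obtain ⟨h1, h2⟩ := hmain r hr
  have hSr : S r = r * x r := by
    conv_lhs => rw [← h1]
    exact hSu _
  have hxr := hxp r hr
  have hr0 := hr.1
  have hur : u (S r) = 1 / x r := by
    rw [hSr]
    field_simp
    nlinarith [h1]
  have hqr : q (S r) = x r ^ 2 / (ρ r / K) + 2 / x r := by
    rw [hSr, ← h2, hQeq r hr]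
  have hρr := hB.density_pos hr
  have hWr : x r ^ 2 / (ρ r / K) + 2 / x r - 2 * (1 / x r) = x r ^ 2 / (ρ r / K) := by ring
  simp only [profileDensity, profileRad, profileTan, hur, hqr, hWr]
  refine ⟨by field_simp, ?_, ?_⟩
  · rw [hprad r hr]
    field_simp
    ring
  · rw [hptan r hr]
    field_simp
    ring

end IsRegularBall

/-! ### From the open interval to `[0, ∞)`, and the bounds. -/

lemma eqOn_cutoff {R : ℝ} (hR : 0 < R) {f g : ℝ → ℝ} (hf : ContinuousOn f (Set.Icc 0 R))
    (hg : Continuous g) (h : Set.EqOn f g (Set.Ioo 0 R)) (hv : ∀ r, R < r → f r = 0) :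
    Set.EqOn f (cutoff R g) (Set.Ici 0) := by
  have hIcc : Set.EqOn f g (Set.Icc 0 R) :=
    h.of_subset_closure hf hg.continuousOn Set.Ioo_subset_Icc_self
      (by rw [closure_Ioo hR.ne])
  intro r hr
  rcases le_or_gt r R with hrR | hrR
  · rw [cutoff_of_le _ hrR]
    exact hIcc ⟨hr, hrR⟩
  · rw [cutoff_of_lt _ hrR, hv r hrR]

/-- The bounds satisfied by the density and the mass of the ball. -/
lemma IsEulerianProfile.bounds {C α : ℝ} {S U U' V : ℝ → ℝ} (h : IsEulerianProfile C α S U U' V)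
    (hα : 0 < α) {K R r : ℝ} (hK : 0 < K) (hr : 0 < r) (hrR : r ≤ R) (hU1 : U r < 1) :
    cutoff R (profileDensity K U V) r < K / α ^ 3 ∧
    4 * Real.pi / 3 * max (cutoff R (profileDensity K U V) r) K * r ^ 3
      < mass (cutoff R (profileDensity K U V)) r ∧
    mass (cutoff R (profileDensity K U V)) r < 4 * Real.pi / 3 * (K / α ^ 3) * r ^ 3 := by
  have hπ := Real.pi_pos
  have hU := h.U_pos hα r
  have hW := h.stretch_pos hα r
  have hS := h.S_pos hα hr
  have h1 := h.lt_U r hr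
  have h2 := h.lt_V r hr
  rw [h.mass_eq hα K hrR hr.le, cutoff_of_le _ hrR]
  have hr3 : r ^ 3 = S r ^ 3 * U r ^ 3 := by rw [← mul_pow, h.S_mul_U r]
  -- The three bounds come from `U < W = V - 2U`, `U < 1` and `α < U`, the mean density being `K /
  -- U³`.
  have hUW : U r ^ 3 < U r ^ 2 * (V r - 2 * U r) := by
    rw [pow_succ]
    gcongr
    linarith
  have hρU : profileDensity K U V r < K / U r ^ 3 := by
    unfold profileDensity
    gcongr
  have hKU : K < K / U r ^ 3 := by
    rw [lt_div_iff₀ (by positivity)]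
    have := pow_lt_one₀ hU.le hU1 three_ne_zero
    nlinarith
  have hUα : K / U r ^ 3 < K / α ^ 3 := by gcongr
  have hmass : 4 * Real.pi / 3 * K * S r ^ 3 = 4 * Real.pi / 3 * (K / U r ^ 3) * r ^ 3 := by
    rw [hr3]; field_simp
  refine ⟨hρU.trans hUα, ?_, ?_⟩
  · rw [hmass]
    have := max_lt hρU hKU
    gcongr
  · rw [hmass]
    gcongr

end ElasticBall

/-! ### Assembly of the theorem. -/

theorem theorem5 (lam mu : ℝ) (hmu : 0 ≤ mu) (hbulk : 0 < 3 * lam + 2 * mu)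
    (K ρc : ℝ) (hK : 0 < K) (hc : 1 < ρc / K) :
    ∃ (R : ℝ) (ρ prad ptan : ℝ → ℝ),
      (ElasticBall.IsStronglyRegularBall R ρ prad ptan ∧
        ElasticBall.IsElastic K (ElasticBall.johnRad lam mu) (ElasticBall.johnTan lam mu)
          ρ prad ptan ∧
        ρ 0 = ρc) ∧
      (∀ (R' : ℝ) (ρ' prad' ptan' : ℝ → ℝ),
        ElasticBall.IsRegularBall R' ρ' prad' ptan' →
        ElasticBall.IsElastic K (ElasticBall.johnRad lam mu) (ElasticBall.johnTan lam mu)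
          ρ' prad' ptan' →
        ρ' 0 = ρc →
        R' = R ∧ Set.EqOn ρ' ρ (Set.Ici 0) ∧ Set.EqOn prad' prad (Set.Ici 0) ∧
          Set.EqOn ptan' ptan (Set.Ici 0)) ∧
      0 < deriv (fun d => ElasticBall.johnRad lam mu d (ρc / K)) (ρc / K) ∧
      ∀ r ∈ Set.Ioc 0 R,
        0 < ρ r ∧
        0 < deriv (fun d => ElasticBall.johnRad lam mu d (ElasticBall.meanDensity K ρ r))
          (ElasticBall.normDensity K ρ r) ∧
        ρ r < ρc ∧
        4 * Real.pi / 3 * max (ρ r) K * r ^ 3 < ElasticBall.mass ρ r ∧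
        ElasticBall.mass ρ r < 4 * Real.pi / 3 * ρc * r ^ 3 := by
  have ha : 0 < lam + 2 * mu := by linarith
  have hδ : 0 < ρc / K := one_pos.trans hc
  set x := (ρc / K) ^ (1 / 3 : ℝ) with hx
  have hx1 : 1 < x := Real.one_lt_rpow hc (by norm_num)
  have hx3 : x ^ 3 = ρc / K := ElasticBall.rpow_third_pow hδ
  have hx0 : 0 < x := one_pos.trans hx1
  -- `α` is the common stretch at the center, less than `1` because the center is compressed.
  obtain ⟨α, hαdef⟩ : ∃ α, α = x⁻¹ := ⟨_, rfl⟩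
  have hα : 0 < α := hαdef ▸ inv_pos.2 hx0
  have hα1 : α < 1 := hαdef ▸ inv_lt_one_of_one_lt₀ hx1
  have hρc : ρc = K / α ^ 3 := by
    rw [hαdef, inv_pow, hx3]
    field_simp
  obtain ⟨C, hC⟩ : ∃ C, C = 4 * Real.pi * K ^ 2 / (3 * (lam + 2 * mu)) := ⟨_, rfl⟩
  have hC0 : 0 < C := by
    have := Real.pi_pos
    rw [hC]
    positivity
  obtain ⟨u, u', q, h⟩ := ElasticBall.exists_isLagrangianProfile hC0 hα
  obtain ⟨S, hSm, hSr, hSs, hS'⟩ := h.exists_inverse hα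
  have hE := h.isEulerianProfile hα hSm hSr hS'
  obtain ⟨s₀, hs₀, hz, hpos, hlt⟩ := h.exists_radius hC0 hα hα1 hmu hbulk
  set U : ℝ → ℝ := fun r => u (S r) with hU
  set V : ℝ → ℝ := fun r => q (S r) with hV
  obtain ⟨R, hRdef⟩ : ∃ R, R = s₀ * u s₀ := ⟨_, rfl⟩
  have hR : 0 < R := hRdef ▸ mul_pos hs₀ (h.u_pos hα s₀)
  have hSR : S R = s₀ := by rw [hRdef, hSs]
  have hS0 := hE.S_zero hα
  have hG : ∀ r ∈ Set.Ico 0 R,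
      0 < 2 * mu * U r ^ 2 + (3 * lam + 4 * mu) - (lam + 2 * mu) * V r := fun r hr =>
    hpos (S r) ⟨hS0 ▸ hSm.monotone hr.1, hSR ▸ hSm hr.2⟩
  have hGR : 2 * mu * U R ^ 2 + (3 * lam + 4 * mu) - (lam + 2 * mu) * V R = 0 := by
    simp only [hU, hV, hSR, hz]
  have hU1 : ∀ r ∈ Set.Ioc 0 R, U r < 1 := fun r hr =>
    hlt (S r) ⟨hS0 ▸ hSm.monotone hr.1.le, hSR ▸ hSm.monotone hr.2⟩
  have hball := hE.isStronglyRegularBall hα hmu ha hK hC hR hG hGR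
  refine ⟨R, ElasticBall.cutoff R (ElasticBall.profileDensity K U V),
    ElasticBall.cutoff R (ElasticBall.profileRad lam mu U V),
    ElasticBall.cutoff R (ElasticBall.profileTan lam mu U V),
    ⟨hball, hE.isElastic hα lam mu hK, ?_⟩, ?_, ElasticBall.deriv_johnRad_pos ha hδ hδ, ?_⟩
  · rw [ElasticBall.cutoff_of_le _ hR.le, ElasticBall.profileDensity, hE.U_zero, hE.V_zero, hρc]
    congr 1
    ring
  · intro R' ρ' prad' ptan' hB' hE' hρ'
    have heq := hB'.eq_profile hE' ha hK hα hC (hρ'.trans hρc) h hSs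
    have hR' := hB'.radius_pos
    have hρ := ElasticBall.eqOn_cutoff hR' hB'.continuousOn_density
      (hE.contDiff_density hα K).continuous (fun r hr => (heq r hr).1) fun r hr =>
        (hB'.vacuum r hr).1
    have hp := ElasticBall.eqOn_cutoff hR' hB'.continuousOn_prad
      (hE.contDiff_rad hα lam mu).continuous (fun r hr => (heq r hr).2.1) fun r hr =>
        (hB'.vacuum r hr).2.1
    have ht := ElasticBall.eqOn_cutoff hR' hB'.continuousOn_ptan
      (hE.contDiff_tan hα lam mu).continuous (fun r hr => (heq r hr).2.2) fun r hr =>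
        (hB'.vacuum r hr).2.2
    -- Both balls follow one profile up to the smaller radius, where one radial pressure vanishes
    -- and, were the radii different, the other would be positive.
    have hRR : R' = R := by
      rcases lt_trichotomy R' R with hlt' | heq' | hgt
      · have h1 := hball.prad_pos R' ⟨hR'.le, hlt'⟩
        have h2 := hp (Set.mem_Ici.2 hR'.le)
        rw [ElasticBall.cutoff_of_le _ le_rfl, hB'.prad_boundary] at h2
        rw [ElasticBall.cutoff_of_le _ hlt'.le, ← h2] at h1
        exact absurd h1 (lt_irrefl _)
      · exact heq'
      · have h1 := hB'.prad_pos R ⟨hR.le, hgt⟩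
        have h2 := hball.prad_boundary
        rw [hp (Set.mem_Ici.2 hR.le), ElasticBall.cutoff_of_le _ hgt.le] at h1
        rw [ElasticBall.cutoff_of_le _ le_rfl] at h2
        exact absurd h1 (h2 ▸ lt_irrefl _)
    subst hRR
    exact ⟨rfl, hρ, hp, ht⟩
  · intro r hr
    have hUr := hE.U_pos hα r
    have hWr := hE.stretch_pos hα r
    have hb := hE.bounds hα hK hr.1 hr.2 (hU1 r hr)
    rw [← hρc] at hb
    refine ⟨?_, ?_, hb⟩
    · rw [ElasticBall.cutoff_of_le _ hr.2]
      exact hE.density_pos hα hK r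
    · rw [hE.meanDensity_eq hα hK hr.2 hr.1,
        ElasticBall.IsEulerianProfile.normDensity_eq hK hr.2]
      exact ElasticBall.deriv_johnRad_pos ha (by positivity) (by positivity)
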